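/- Let $\mathbb K$ be $\mathbb R$ or $\mathbb C$ and let $X$ be a Banach space over $\mathbb K$. Definitions. For $1<p<\infty$ and $A\subset\mathbb K$, the UMD$_p^A$ constant $\beta_{p,X}^A\in[0,\infty]$ is the least $\beta\in[0,\infty]$ such that $$\Bigl(\mathbb E\Bigl\|\sum_{n=1}^N\varepsilon_n d_n\Bigr\|^p\Bigr)^{1/p}\le\beta\Bigl(\mathbb E\Bigl\|\sum_{n=1}^N d_n\Bigr\|^p\Bigr)^{1/p}$$ for every $N$, every $X$-valued martingale difference sequence $(d_n)_{n=1}^N$ in $L^p(\Omega;X)$ on a probability space $\Omega$, and all $\varepsilon_1,\dots,\varepsilon_N\in A$. The space $X$ is called UMD if for some $p\in(1,\infty)$ this inequality holds with a finite $\beta$ for $A=\{\varepsilon\in\mathbb K:|\varepsilon|=1\}$. For $X$-valued processes $f=(f_n)_{n\ge0}$ and $g=(g_n)_{n\ge0}$, $g$ is $A$-weakly differentially subordinated to $f$ if for each $x^*\in X^*$ one has, almost surely, $$\frac{\langle g_0,x^*\rangle}{\langle f_0,x^*\rangle}\in A\quad\text{and}\quad\frac{\langle g_n-g_{n-1},x^*\rangle}{\langle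 f_n-f_{n-1},x^*\rangle}\in A\quad\text{for all } n\ge1,$$ with the convention that $\frac00\in A$, and $\frac c0=\infty\notin A$ for $c\ne0$. For $1<p<\infty$, a convex, bounded, closed set $A\subset\mathbb K$ with at least two points, and $\beta\ge0$, consider the property $(*)$ for every probability space, every filtration $(\mathcal F_n)_{n\ge0}$ on it, and all $X$-valued local $(\mathcal F_n)$-martingales $(f_n)_{n\ge0}$ and $(g_n)_{n\ge0}$ such that $g$ is $A$-weakly differentially subordinated to $f$, $$\mathbb E\|g_n\|^p\le\beta^p\,\mathbb E\|f_n\|^p\quad\text{for all } n\ge0$$ (both expectations are in $[0,\infty]$). Theorem. The following are equivalent: 1. $X$ is a UMD space; 2. for some $1<p<\infty$ and some convex, bounded, closed $A\subset\mathbb K$ with at least two points there is a constant $\beta>0$ satisfying $(*)$; 3. for all $1<p<\infty$ and all convex, bounded, closed $A\subset\mathbb K$ with at least two points there is a constant $\beta>0$ satisfying $(*)$. If this is the case, then for all such $p$ and $A$ the constant $\beta_{p,X}^A$ is finite, and it is the least $\beta\ge0$ satisfying $(*)$. -/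

import Mathlib

open MeasureTheory ProbabilityTheory
open scoped ENNReal NNReal

universe u v w

noncomputable section

/-- `d 0, d 1, …` is an `X`-valued martingale difference sequence in `L^p` for the filtration `ℱ`:
every `d n` lies in `L^p` and the partial sums `d 0 + ⋯ + d n` form a martingale. A finite
martingale difference sequence is one that is continued by zeros. -/
structure IsLpMartingaleDifference {X : Type v} [NormedAddCommGroup X] [NormedSpace ℝ X]
    [CompleteSpace X] {Ω : Type w} {m : MeasurableSpace Ω} (p : ℝ)
    (d : ℕ → Ω → X) (ℱ : Filtration ℕ m) (μ : Measure Ω) : Prop where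
  memLp : ∀ n, MemLp (d n) (ENNReal.ofReal p) μ
  martingale : Martingale (fun n ω => ∑ k ∈ Finset.range (n + 1), d k ω) ℱ μ

/-- The inequality `‖∑ ε_n d_n‖_{L^p} ≤ β ‖∑ d_n‖_{L^p}` for all finite `X`-valued `L^p` martingale
difference sequences on all probability spaces, and all finite sequences `ε` in `A`. -/
def UMDInequality (𝕜 : Type u) [RCLike 𝕜] (X : Type v) [NormedAddCommGroup X] [NormedSpace 𝕜 X]
    [NormedSpace ℝ X] [CompleteSpace X] (p : ℝ) (A : Set 𝕜) (β : ℝ≥0∞) : Prop :=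
  ∀ (Ω : Type w) (m : MeasurableSpace Ω) (μ : Measure Ω), IsProbabilityMeasure μ →
    ∀ (ℱ : Filtration ℕ m) (d : ℕ → Ω → X), IsLpMartingaleDifference p d ℱ μ →
    ∀ (N : ℕ) (ε : ℕ → 𝕜), (∀ n < N, ε n ∈ A) →
      eLpNorm (fun ω => ∑ n ∈ Finset.range N, ε n • d n ω) (ENNReal.ofReal p) μ ≤
        β * eLpNorm (fun ω => ∑ n ∈ Finset.range N, d n ω) (ENNReal.ofReal p) μ

/-- `X` is a UMD Banach space: for some `1 < p < ∞` the UMD inequality holds with a finite constant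
for all scalars of modulus one. -/
def IsUMD (𝕜 : Type u) [RCLike 𝕜] (X : Type v) [NormedAddCommGroup X] [NormedSpace 𝕜 X]
    [NormedSpace ℝ X] [CompleteSpace X] : Prop :=
  ∃ p : ℝ, 1 < p ∧ ∃ β : ℝ≥0, 0 < β ∧ UMDInequality.{u, v, w} 𝕜 X p {ε : 𝕜 | ‖ε‖ = 1} β

/-- The `UMD_p^A` constant `β_{p,X}^A ∈ [0, ∞]`. -/
def umdConst (𝕜 : Type u) [RCLike 𝕜] (X : Type v) [NormedAddCommGroup X] [NormedSpace 𝕜 X]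
    [NormedSpace ℝ X] [CompleteSpace X] (p : ℝ) (A : Set 𝕜) : ℝ≥0∞ :=
  sInf {β : ℝ≥0∞ | UMDInequality.{u, v, w} 𝕜 X p A β}

/-- `c / d ∈ A` in the convention that `0 / 0` belongs to `A`, while `c / 0` is infinite, hence not
in `A`, for `c ≠ 0`. -/
def QuotientMem {𝕜 : Type u} [RCLike 𝕜] (A : Set 𝕜) (c d : 𝕜) : Prop :=
  (d = 0 → c = 0) ∧ (d ≠ 0 → c / d ∈ A)

/-- `g` is `A`-weakly differentially subordinated to `f`. The exceptional null sets may depend on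
the functional. -/
structure WeaklyDiffSubordinate {𝕜 : Type u} [RCLike 𝕜] {X : Type v} [NormedAddCommGroup X]
    [NormedSpace 𝕜 X] {Ω : Type w} {m : MeasurableSpace Ω} (A : Set 𝕜) (g f : ℕ → Ω → X)
    (μ : Measure Ω) : Prop where
  zero : ∀ φ : StrongDual 𝕜 X, ∀ᵐ ω ∂μ, QuotientMem A (φ (g 0 ω)) (φ (f 0 ω))
  succ : ∀ φ : StrongDual 𝕜 X, ∀ n : ℕ, ∀ᵐ ω ∂μ,
    QuotientMem A (φ (g (n + 1) ω - g n ω)) (φ (f (n + 1) ω - f n ω))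

/-- A discrete `X`-valued local martingale: an adapted process that is locally, that is, when
stopped along a localizing sequence of stopping times, a martingale. -/
def IsLocalMartingale {X : Type v} [NormedAddCommGroup X] [NormedSpace ℝ X] [CompleteSpace X]
    {Ω : Type w} {m : MeasurableSpace Ω} (f : ℕ → Ω → X) (ℱ : Filtration ℕ m) (μ : Measure Ω) :
    Prop :=
  StronglyAdapted ℱ f ∧ Locally (fun Y : ℕ → Ω → X => Martingale Y ℱ μ) ℱ f μ

/-- `𝔼 ‖g n‖ ^ p ≤ β ^ p 𝔼 ‖f n‖ ^ p` (expectations in `[0, ∞]`) for all `n` and all `X`-valued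
local martingales `f`, `g`, with a common filtration on any probability space, such that `g` is
`A`-weakly differentially subordinated to `f`. -/
def SubordinationInequality (𝕜 : Type u) [RCLike 𝕜] (X : Type v) [NormedAddCommGroup X]
    [NormedSpace 𝕜 X] [NormedSpace ℝ X] [CompleteSpace X] (p : ℝ) (A : Set 𝕜) (β : ℝ≥0∞) : Prop :=
  ∀ (Ω : Type w) (m : MeasurableSpace Ω) (μ : Measure Ω), IsProbabilityMeasure μ →
    ∀ (ℱ : Filtration ℕ m) (f g : ℕ → Ω → X),
      IsLocalMartingale f ℱ μ → IsLocalMartingale g ℱ μ → WeaklyDiffSubordinate A g f μ →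
      ∀ n : ℕ, ∫⁻ ω, ‖g n ω‖ₑ ^ p ∂μ ≤ β ^ p * ∫⁻ ω, ‖f n ω‖ₑ ^ p ∂μ

/-- The sets of scalars under consideration: convex, bounded, closed, with at least two points. -/
structure IsScalarBody {𝕜 : Type u} [RCLike 𝕜] (A : Set 𝕜) : Prop where
  convex : Convex ℝ A
  bounded : Bornology.IsBounded A
  closed : IsClosed A
  nontrivial : A.Nontrivial

end

open Filter Topology

/-! Both inequalities are compared with `WalshUMD`, which concerns only finite dyadic walks whose
coefficients in `A` may depend on the past. The UMD inequality with constant β implies it with `B =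
β ^ p`: if the nodes of a tree are visited one after the other, predictable coefficients become
deterministic (`WalshTree.exists_martingale`).

Walks produce Burkholder's function `burkholderFun`. It majorizes `‖y‖ ^ p - B ‖x‖ ^ p`, is
nonpositive at the points `(x, ε • x)`, and is concave along every direction `(z, ε • z)` with `ε ∈
A`, because trees can be grafted onto a new root. Weak subordination yields increments `(Z, a • Z)`
with a random scalar `a` in `A` (`exists_measurable_coeff`). The mean of Burkholder's function along
`(f, g)` does not increase, which is the subordination inequality with the same β. The difficulty is
that `a` need not be predictable: `Z` is not centred on the sets `{a = c}`, and the function is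
concave only in separate directions. The gains on these sets are therefore compared with drops along
a chain of small steps whose total displacement is governed by the means of `Z` and `a • Z`, which
are zero (`exists_sum_setIntegral_sub_le`, `integral_comp_add_le`).

Conversely, deterministic transforms are a special case of subordination. Hence the two inequalities
have the same finite constants, which gives the sharp constant. Independence of the exponent follows
from a good-λ argument for walks (`WalshUMD.extrapolate`), independence of `A` from affine and
convex combinations of transforms. Local martingales cause no trouble in discrete time: a finite
`p`-th moment at time `n` passes to all earlier times, and the increments up to time `n` are then
conditionally centred. -/

/-! ### Midpoint concavity, concavity and continuity -/

/-- Midpoint concave continuous functions are concave. -/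
theorem concaveOn_univ_of_midpoint_of_continuous {E : Type*} [AddCommGroup E] [Module ℝ E]
    [TopologicalSpace E] [ContinuousAdd E] [ContinuousSMul ℝ E] {h : E → ℝ} (hc : Continuous h)
    (hm : ∀ x z, (h (x + z) + h (x - z)) / 2 ≤ h x) : ConcaveOn ℝ Set.univ h := by
  refine ⟨convex_univ, fun x _ y _ a b ha hb hab => ?_⟩
  set φ : ℝ → ℝ := fun t => h (x + t • (y - x)) - ((1 - t) * h x + t * h y) with hφ
  have hφc : Continuous φ := by fun_prop
  have hφ0 : φ 0 = 0 := by simp [hφ]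
  have hφ1 : φ 1 = 0 := by simp [hφ]
  have hφm : ∀ t s, (φ (t + s) + φ (t - s)) / 2 ≤ φ t := by
    intro t s
    have := hm (x + t • (y - x)) (s • (y - x))
    rw [add_assoc, ← add_smul, add_sub_assoc, ← sub_smul] at this
    simp only [hφ]
    linarith
  have hpos : ∀ t ∈ Set.Icc (0 : ℝ) 1, 0 ≤ φ t := by
    obtain ⟨t₁, ht₁, hmin⟩ := isCompact_Icc.exists_isMinOn
      (Set.nonempty_Icc.2 zero_le_one) hφc.continuousOn (s := Set.Icc (0 : ℝ) 1)
    by_contra! hneg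
    obtain ⟨t₂, ht₂, hneg⟩ := hneg
    have hm1 : φ t₁ < 0 := lt_of_le_of_lt (hmin ht₂) hneg
    -- Let `t₀` be the leftmost minimizer. Midpoint concavity at `t₀` forces `t₀ - s` to be a
    -- minimizer as well, which is absurd.
    have hcomp : IsCompact (Set.Icc (0 : ℝ) 1 ∩ {t | φ t ≤ φ t₁}) :=
      isCompact_Icc.inter_right (isClosed_le hφc continuous_const)
    obtain ⟨t₀, ⟨ht₀, ht₀'⟩, hleast⟩ := hcomp.exists_isLeast ⟨t₁, ht₁, (le_refl (φ t₁) :)⟩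
    have h0 : 0 < t₀ := by
      rcases ht₀.1.eq_or_lt with h | h
      · rw [← h] at ht₀'; simp only [Set.mem_ofPred_eq] at ht₀'; linarith
      · exact h
    have h1 : t₀ < 1 := by
      rcases ht₀.2.eq_or_lt with h | h
      · rw [h] at ht₀'; simp only [Set.mem_ofPred_eq] at ht₀'; linarith
      · exact h
    set s := min t₀ (1 - t₀)
    have hs : 0 < s := lt_min h0 (by linarith)
    have hs1 : s ≤ t₀ := min_le_left _ _
    have hs2 : s ≤ 1 - t₀ := min_le_right _ _
    have hmem1 : t₀ + s ∈ Set.Icc (0 : ℝ) 1 := ⟨by linarith, by linarith⟩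
    have hmem2 : t₀ - s ∈ Set.Icc (0 : ℝ) 1 := ⟨by linarith, by linarith⟩
    have e1 : φ t₁ ≤ φ (t₀ + s) := hmin hmem1
    have e2 := hφm t₀ s
    have e3 : φ t₀ ≤ φ t₁ := ht₀'
    have := hleast ⟨hmem2, (by simp only [Set.mem_ofPred_eq]; linarith)⟩
    linarith
  have := hpos b ⟨hb, by linarith⟩
  simp only [hφ] at this
  have e : x + b • (y - x) = a • x + b • y := by
    rw [← eq_sub_iff_add_eq] at hab
    rw [hab, smul_sub, sub_smul, one_smul]; abel
  rw [e, ← hab] at this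
  simp only [smul_eq_mul]
  have e4 : a + b - b = a := by ring
  rw [e4] at this
  linarith

/-- A function that is midpoint concave along a spanning cone of directions and bounded on bounded
sets is continuous. -/
theorem continuous_of_midpoint_of_bounded {E : Type*} [NormedAddCommGroup E] [NormedSpace ℝ E]
    {F : E → ℝ} {D : Set E} {K : ℝ} (hD : ∀ ξ ∈ D, ∀ t : ℝ, t • ξ ∈ D)
    (hspan : ∀ ξ, ∃ ξ₁ ∈ D, ∃ ξ₂ ∈ D, ξ = ξ₁ + ξ₂ ∧ ‖ξ₁‖ ≤ K * ‖ξ‖ ∧ ‖ξ₂‖ ≤ K * ‖ξ‖)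
    (hF : ∀ ζ, ∀ ξ ∈ D, (F (ζ + ξ) + F (ζ - ξ)) / 2 ≤ F ζ)
    (hbdd : ∀ R, ∃ M, ∀ ζ, ‖ζ‖ ≤ R → |F ζ| ≤ M) : Continuous F := by
  -- By repeated doubling, the drop over `ξ` is at most `2⁻ᵏ` times the drop over `2ᵏ • ξ`. Used
  -- from `ζ` forwards and from `ζ + ξ` backwards, this makes `F` vary little along short steps,
  -- since `F` is bounded on bounded sets.
  have low : ∀ k : ℕ, ∀ ζ, ∀ ξ ∈ D, F ζ - (1 / 2) ^ k * (F ζ - F (ζ + (2 : ℝ) ^ k • ξ)) ≤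
      F (ζ + ξ) := by
    intro k
    induction k with
    | zero => intro ζ ξ hξ; simp
    | succ k ih =>
      intro ζ ξ hξ
      refine le_trans ?_ (ih ζ ξ hξ)
      have h1 := hF (ζ + (2 : ℝ) ^ k • ξ) _ (hD ξ hξ (2 ^ k))
      rw [add_assoc, ← add_smul, add_sub_cancel_right] at h1
      have e : (2 : ℝ) ^ k + 2 ^ k = 2 ^ (k + 1) := by ring
      rw [e] at h1
      have : (0 : ℝ) ≤ (1 / 2) ^ k := by positivity
      rw [pow_succ]
      nlinarith
  have step : ∀ k : ℕ, ∀ M ζ, ∀ ξ ∈ D, ‖(2 : ℝ) ^ k • ξ‖ ≤ 1 →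
      (∀ η, ‖η‖ ≤ ‖ζ‖ + 2 → |F η| ≤ M) → |F (ζ + ξ) - F ζ| ≤ (1 / 2) ^ k * (2 * M) := by
    intro k M ζ ξ hξ hk hM
    have hpow : (0 : ℝ) ≤ (1 / 2) ^ k := by positivity
    have hξ1 : ‖ξ‖ ≤ 1 := by
      rw [norm_smul, norm_pow, Real.norm_ofNat] at hk
      have : (1 : ℝ) ≤ 2 ^ k := one_le_pow₀ one_le_two
      nlinarith [norm_nonneg ξ]
    have a0 := abs_le.1 (hM ζ (by linarith))
    have a1 := abs_le.1 (hM (ζ + ξ) (by linarith [norm_add_le ζ ξ]))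
    have a2 := abs_le.1 (hM (ζ + (2 : ℝ) ^ k • ξ) (by linarith [norm_add_le ζ ((2 : ℝ) ^ k • ξ)]))
    have a3 := abs_le.1 (hM (ζ + ξ + (2 : ℝ) ^ k • (-ξ)) (by
      have e1 := norm_add_le (ζ + ξ) ((2 : ℝ) ^ k • (-ξ))
      rw [smul_neg, norm_neg] at e1
      rw [smul_neg]
      linarith [norm_add_le ζ ξ]))
    have b1 := low k ζ ξ hξ
    have b2 := low k (ζ + ξ) (-ξ) (by simpa using hD ξ hξ (-1))
    rw [add_neg_cancel_right] at b2
    rw [abs_le]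
    constructor
    · nlinarith
    · nlinarith
  rw [continuous_iff_continuousAt]
  intro ζ
  rw [Metric.continuousAt_iff]
  intro ε hε
  obtain ⟨M, hM⟩ := hbdd (‖ζ‖ + 3)
  have hM0 : 0 ≤ M := (abs_nonneg _).trans (hM ζ (by linarith))
  obtain ⟨k, hk⟩ := exists_pow_lt_of_lt_one (show 0 < ε / (4 * M + 1) by positivity)
    (show (1 / 2 : ℝ) < 1 by norm_num)
  rw [lt_div_iff₀ (by positivity)] at hk
  have hpow : (0 : ℝ) < (1 / 2) ^ k := by positivity
  refine ⟨1 / (2 ^ k * (|K| + 1)), by positivity, fun {η} hη => ?_⟩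
  obtain ⟨ξ₁, h1, ξ₂, h2, hsum, n1, n2⟩ := hspan (η - ζ)
  rw [dist_eq_norm, lt_div_iff₀ (by positivity)] at hη
  have small : ∀ ξ : E, ‖ξ‖ ≤ K * ‖η - ζ‖ → ‖(2 : ℝ) ^ k • ξ‖ ≤ 1 := by
    intro ξ hξ
    rw [norm_smul, norm_pow, Real.norm_ofNat]
    have : ‖ξ‖ ≤ (|K| + 1) * ‖η - ζ‖ :=
      hξ.trans (mul_le_mul_of_nonneg_right (by linarith [le_abs_self K]) (norm_nonneg _))
    have h2k : (0 : ℝ) < 2 ^ k := by positivity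
    nlinarith
  have s1 := small ξ₁ n1
  have s2 := small ξ₂ n2
  have hξ1 : ‖ξ₁‖ ≤ 1 := by
    rw [norm_smul, norm_pow, Real.norm_ofNat] at s1
    have : (1 : ℝ) ≤ 2 ^ k := one_le_pow₀ one_le_two
    nlinarith [norm_nonneg ξ₁]
  have c1 := step k M ζ ξ₁ h1 s1 (fun x hx => hM x (by linarith))
  have c2 := step k M (ζ + ξ₁) ξ₂ h2 s2 (fun x hx => hM x (by linarith [norm_add_le ζ ξ₁]))
  have e : η = ζ + ξ₁ + ξ₂ := by rw [add_assoc, ← hsum]; abel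
  rw [Real.dist_eq, e]
  have := abs_sub_le (F (ζ + ξ₁ + ξ₂)) (F (ζ + ξ₁)) (F ζ)
  nlinarith

/-! ### Dyadic walks -/

/-- Finite predictable dyadic walks: at a node one moves by `±z`, and the transformed walk moves by
`±ε • z`. -/
inductive WalshTree (𝕜 : Type u) (X : Type v) : Type (max u v)
  | leaf : WalshTree 𝕜 X
  | node (ε : 𝕜) (z : X) (l r : WalshTree 𝕜 X) : WalshTree 𝕜 X

namespace WalshTree

/-- All coefficients of the tree belong to `A`. -/
def CoeffIn {𝕜 : Type u} {X : Type v} (A : Set 𝕜) : WalshTree 𝕜 X → Prop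
  | leaf => True
  | node ε _ l r => ε ∈ A ∧ l.CoeffIn A ∧ r.CoeffIn A

theorem coeffIn_univ {𝕜 : Type u} {X : Type v} (T : WalshTree 𝕜 X) :
    T.CoeffIn (Set.univ : Set 𝕜) := by
  induction T with
  | leaf => trivial
  | node ε z l r ihl ihr => exact ⟨trivial, ihl, ihr⟩

/-- The expectation of a function of the final state, for states that evolve along the tree. -/
noncomputable def run {𝕜 : Type u} {X : Type v} {σ : Type*} (step : 𝕜 → X → σ → σ × σ)
    (Φ : σ → ℝ) : WalshTree 𝕜 X → σ → ℝ
  | leaf, s => Φ s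
  | node ε z l r, s => (l.run step Φ (step ε z s).1 + r.run step Φ (step ε z s).2) / 2

/-- The step of the walk and its transform. -/
def walkStep {𝕜 : Type u} {X : Type v} [AddCommGroup X] [SMul 𝕜 X] (ε : 𝕜) (z : X) (s : X × X) :
    (X × X) × (X × X) :=
  ((s.1 + z, s.2 + ε • z), (s.1 - z, s.2 - ε • z))

/-- The expectation of a function of the final position of the walk and its transform. -/
noncomputable def mean {𝕜 : Type u} {X : Type v} [AddCommGroup X] [SMul 𝕜 X] (Φ : X × X → ℝ)
    (T : WalshTree 𝕜 X) (s : X × X) : ℝ :=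
  T.run walkStep Φ s

end WalshTree

/-- The function `‖y‖ ^ p - B ‖x‖ ^ p`. -/
noncomputable def powGain {X : Type v} [NormedAddCommGroup X] (p B : ℝ) (s : X × X) : ℝ :=
  ‖s.2‖ ^ p - B * ‖s.1‖ ^ p

/-- The UMD inequality for dyadic walks with predictable coefficients. -/
def WalshUMD (𝕜 : Type u) [RCLike 𝕜] (X : Type v) [NormedAddCommGroup X] [NormedSpace 𝕜 X]
    (p : ℝ) (A : Set 𝕜) (B : ℝ) : Prop :=
  ∀ T : WalshTree 𝕜 X, T.CoeffIn A → ∀ x : X, ∀ ε ∈ A, T.mean (powGain p B) (x, ε • x) ≤ 0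

/-- Burkholder's function: the least zigzag concave majorant of `powGain`. -/
noncomputable def burkholderFun {𝕜 : Type u} [RCLike 𝕜] {X : Type v} [NormedAddCommGroup X]
    [NormedSpace 𝕜 X] (p : ℝ) (A : Set 𝕜) (B : ℝ) (s : X × X) : ℝ :=
  ⨆ T : {T : WalshTree 𝕜 X // T.CoeffIn A}, T.1.mean (powGain p B) s

/-! ### Growth, continuity and zigzag concavity of Burkholder's function -/

section Burkholder

variable {𝕜 : Type u} [RCLike 𝕜] {X : Type v} [NormedAddCommGroup X] [NormedSpace 𝕜 X]
  {p B : ℝ} {A : Set 𝕜}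

/-- Cramer's rule for `u + v = s.1`, `α • u + γ • v = s.2`: two distinct coefficients already give
directions that span `X × X`, with norm control. This is how the two points of `A` enter. -/
theorem exists_zigzag_decomposition {α γ : 𝕜} (h : α ≠ γ) (s : X × X) :
    ∃ u v : X, s = (u + v, α • u + γ • v) ∧
      ‖u‖ ≤ (‖γ - α‖⁻¹ * (‖α‖ + ‖γ‖ + 1)) * ‖s‖ ∧ ‖v‖ ≤ (‖γ - α‖⁻¹ * (‖α‖ + ‖γ‖ + 1)) * ‖s‖ := by
  have h' : γ - α ≠ 0 := sub_ne_zero.2 h.symm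
  have hx : ‖s.1‖ ≤ ‖s‖ := norm_fst_le s
  have hy : ‖s.2‖ ≤ ‖s‖ := norm_snd_le s
  have key : ∀ w : X, ‖w‖ ≤ (‖α‖ + ‖γ‖ + 1) * ‖s‖ →
      ‖(γ - α)⁻¹ • w‖ ≤ (‖γ - α‖⁻¹ * (‖α‖ + ‖γ‖ + 1)) * ‖s‖ := by
    intro w hw
    rw [norm_smul, norm_inv, mul_assoc]
    exact mul_le_mul_of_nonneg_left hw (by positivity)
  refine ⟨(γ - α)⁻¹ • (γ • s.1 - s.2), (γ - α)⁻¹ • (s.2 - α • s.1), ?_, key _ ?_, key _ ?_⟩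
  · apply Prod.ext
    · simp only
      rw [← smul_add, sub_add_sub_cancel, ← sub_smul, smul_smul, inv_mul_cancel₀ h', one_smul]
    · simp only
      match_scalars
      · field_simp
        ring
      · field_simp
        ring
  · refine (norm_sub_le _ _).trans ?_
    rw [norm_smul]
    nlinarith [norm_nonneg α, norm_nonneg γ, norm_nonneg s]
  · refine (norm_sub_le _ _).trans ?_
    rw [norm_smul]
    nlinarith [norm_nonneg α, norm_nonneg γ, norm_nonneg s]

/-- Start on the diagonal at `(u, α • u)` and move by `±v` with coefficient `γ`. One branch
continues with `T`, the other stops at once, and the average of the two is nonpositive. Thus means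
from arbitrary starting points are bounded independently of the tree. -/
theorem mean_le_of_walshUMD (hU : WalshUMD 𝕜 X p A B) {α γ : 𝕜} (hα : α ∈ A) (hγ : γ ∈ A)
    (u v : X) {T : WalshTree 𝕜 X} (hT : T.CoeffIn A) :
    T.mean (powGain p B) (u + v, α • u + γ • v) ≤ -powGain p B (u - v, α • u - γ • v) := by
  have := hU (.node γ v T .leaf) ⟨hγ, hT, trivial⟩ u α hα
  simp only [WalshTree.mean, WalshTree.run, WalshTree.walkStep] at this ⊢
  linarith

theorem bddAbove_mean (hU : WalshUMD 𝕜 X p A B) (hA : A.Nontrivial) (s : X × X) :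
    BddAbove (Set.range fun T : {T : WalshTree 𝕜 X // T.CoeffIn A} =>
      T.1.mean (powGain p B) s) := by
  obtain ⟨α, hα, γ, hγ, h⟩ := hA
  obtain ⟨u, v, rfl, -, -⟩ := exists_zigzag_decomposition h s
  refine ⟨-powGain p B (u - v, α • u - γ • v), ?_⟩
  rintro _ ⟨T, rfl⟩
  exact mean_le_of_walshUMD hU hα hγ u v T.2

instance : Nonempty {T : WalshTree 𝕜 X // T.CoeffIn A} := ⟨⟨.leaf, trivial⟩⟩

theorem mean_le_burkholderFun (hU : WalshUMD 𝕜 X p A B) (hA : A.Nontrivial) (s : X × X)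
    {T : WalshTree 𝕜 X} (hT : T.CoeffIn A) :
    T.mean (powGain p B) s ≤ burkholderFun p A B s :=
  le_ciSup (bddAbove_mean hU hA s) ⟨T, hT⟩

theorem powGain_le_burkholderFun (hU : WalshUMD 𝕜 X p A B) (hA : A.Nontrivial) (s : X × X) :
    powGain p B s ≤ burkholderFun p A B s :=
  mean_le_burkholderFun hU hA s (T := .leaf) trivial

theorem burkholderFun_diag_nonpos (hU : WalshUMD 𝕜 X p A B) (x : X) {ε : 𝕜} (hε : ε ∈ A) :
    burkholderFun p A B (x, ε • x) ≤ 0 :=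
  ciSup_le fun T => hU T.1 T.2 x ε hε

/-- Arbitrary trees for the two shifted points are grafted onto a root `(ε, z)`, which competes in
the supremum at `s`. -/
theorem burkholderFun_midpoint (hU : WalshUMD 𝕜 X p A B) (hA : A.Nontrivial) {ε : 𝕜} (hε : ε ∈ A)
    (s : X × X) (z : X) :
    (burkholderFun p A B (s + (z, ε • z)) + burkholderFun p A B (s - (z, ε • z))) / 2 ≤
      burkholderFun p A B s := by
  have h1 : burkholderFun p A B (s + (z, ε • z)) ≤
      2 * burkholderFun p A B s - burkholderFun p A B (s - (z, ε • z)) := by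
    refine ciSup_le fun L => ?_
    rw [le_sub_comm]
    refine ciSup_le fun R => ?_
    have := mean_le_burkholderFun hU hA s (T := .node ε z L.1 R.1) ⟨hε, L.2, R.2⟩
    simp only [WalshTree.mean, WalshTree.run, WalshTree.walkStep] at this ⊢
    rw [Prod.add_def, Prod.sub_def]
    linarith
  linarith

/-- The lower bound comes from the one-leaf tree, the upper bound from `mean_le_of_walshUMD`. This
growth makes all later integrals finite and dominates all limits. -/
theorem exists_abs_burkholderFun_le (hU : WalshUMD 𝕜 X p A B) (hA : A.Nontrivial) (hp : 0 < p)
    (hB : 0 ≤ B) : ∃ C, 0 ≤ C ∧ ∀ s : X × X, |burkholderFun p A B s| ≤ C * ‖s‖ ^ p := by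
  obtain ⟨α, hα, γ, hγ, h⟩ := id hA
  set K := ‖γ - α‖⁻¹ * (‖α‖ + ‖γ‖ + 1)
  have hK : 0 ≤ K := by positivity
  refine ⟨B + B * (2 * K) ^ p, by positivity, fun s => ?_⟩
  have hs : 0 ≤ ‖s‖ ^ p := by positivity
  have hBs : 0 ≤ B * ‖s‖ ^ p := by positivity
  have hBs' : 0 ≤ B * (2 * K) ^ p * ‖s‖ ^ p := by positivity
  rw [abs_le]
  constructor
  · refine le_trans ?_ (powGain_le_burkholderFun hU hA s)
    have h1 : ‖s.1‖ ^ p ≤ ‖s‖ ^ p :=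
      Real.rpow_le_rpow (norm_nonneg _) (norm_fst_le s) hp.le
    have h2 : 0 ≤ ‖s.2‖ ^ p := by positivity
    have := mul_le_mul_of_nonneg_left h1 hB
    unfold powGain
    linarith
  · refine ciSup_le fun T => ?_
    obtain ⟨u, v, hs', hu, hv⟩ := exists_zigzag_decomposition h s
    have h0 := mean_le_of_walshUMD hU hα hγ u v T.2
    rw [← hs'] at h0
    refine h0.trans ?_
    have h1 : ‖u - v‖ ^ p ≤ (2 * K) ^ p * ‖s‖ ^ p := by
      rw [← Real.mul_rpow (by positivity) (norm_nonneg _)]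
      refine Real.rpow_le_rpow (norm_nonneg _) ((norm_sub_le _ _).trans ?_) hp.le
      linarith
    have h2 : 0 ≤ ‖α • u - γ • v‖ ^ p := by positivity
    have := mul_le_mul_of_nonneg_left h1 hB
    unfold powGain
    linarith

variable [NormedSpace ℝ X] [IsScalarTower ℝ 𝕜 X]

/-- Midpoint concavity is available only along zigzag directions, but every vector is a controlled
sum of two of them, and the growth bound gives boundedness on bounded sets. -/
theorem continuous_burkholderFun (hU : WalshUMD 𝕜 X p A B) (hA : A.Nontrivial) (hp : 0 < p)
    (hB : 0 ≤ B) : Continuous (burkholderFun p A B : X × X → ℝ) := by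
  obtain ⟨α, hα, γ, hγ, h⟩ := id hA
  set K := ‖γ - α‖⁻¹ * (‖α‖ + ‖γ‖ + 1)
  obtain ⟨C, hC0, hC⟩ := exists_abs_burkholderFun_le (X := X) hU hA hp hB
  refine continuous_of_midpoint_of_bounded (D := {ξ | ∃ ε ∈ A, ∃ z : X, ‖ε‖ ≤ ‖α‖ + ‖γ‖ ∧
    ξ = (z, ε • z)}) (K := (‖α‖ + ‖γ‖ + 1) * K) ?_ ?_ ?_ ?_
  · rintro _ ⟨ε, hε, z, hn, rfl⟩ t
    exact ⟨ε, hε, t • z, hn, by rw [Prod.smul_mk, smul_comm t ε z]⟩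
  · intro ξ
    obtain ⟨u, v, hs', hu, hv⟩ := exists_zigzag_decomposition h ξ
    have key : ∀ (ε : 𝕜) (u : X), ‖ε‖ ≤ ‖α‖ + ‖γ‖ → ‖u‖ ≤ K * ‖ξ‖ →
        ‖(u, ε • u)‖ ≤ (‖α‖ + ‖γ‖ + 1) * K * ‖ξ‖ := by
      intro ε u hε hu
      rw [mul_assoc]
      have h0 := norm_nonneg u
      have h1 := norm_nonneg ε
      refine max_le ?_ ?_
      · simp only; nlinarith
      · simp only [norm_smul]; nlinarith
    have nα : ‖α‖ ≤ ‖α‖ + ‖γ‖ := by linarith [norm_nonneg γ]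
    have nγ : ‖γ‖ ≤ ‖α‖ + ‖γ‖ := by linarith [norm_nonneg α]
    exact ⟨(u, α • u), ⟨α, hα, u, nα, rfl⟩, (v, γ • v), ⟨γ, hγ, v, nγ, rfl⟩, hs',
      key α u nα hu, key γ v nγ hv⟩
  · rintro ζ _ ⟨ε, hε, z, -, rfl⟩
    exact burkholderFun_midpoint hU hA hε ζ z
  · intro R
    refine ⟨C * |R| ^ p, fun ζ hζ => (hC ζ).trans ?_⟩
    exact mul_le_mul_of_nonneg_left
      (Real.rpow_le_rpow (norm_nonneg _) (hζ.trans (le_abs_self R)) hp.le) hC0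

theorem concaveOn_burkholderFun (hU : WalshUMD 𝕜 X p A B) (hA : A.Nontrivial) (hp : 0 < p)
    (hB : 0 ≤ B) {ε : 𝕜} (hε : ε ∈ A) (s : X × X) :
    ConcaveOn ℝ Set.univ fun z : X => burkholderFun p A B (s + (z, ε • z)) := by
  refine concaveOn_univ_of_midpoint_of_continuous ?_ fun x z => ?_
  · exact (continuous_burkholderFun hU hA hp hB).comp (by fun_prop)
  · have := burkholderFun_midpoint hU hA hε (s + (x, ε • x)) z
    convert this using 4
    · ext <;> simp [smul_add, add_assoc]
    · ext <;> simp [smul_sub, add_sub_assoc]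

end Burkholder

/-! ### Expectations along a tree and Doob's inequality -/

namespace WalshTree

section Run

variable {𝕜 : Type u} {X : Type v} {σ : Type*} {step : 𝕜 → X → σ → σ × σ} {A : Set 𝕜}
  {Inv : σ → Prop}

/-- The expectation `run` is a weighted sum over final states that satisfy every invariant of the
evolution. -/
theorem exists_leaves (hInv : ∀ ε ∈ A, ∀ z s, Inv s → Inv (step ε z s).1 ∧ Inv (step ε z s).2)
    {T : WalshTree 𝕜 X} (hT : T.CoeffIn A) {s : σ} (hs : Inv s) :
    ∃ (ι : Type) (_ : Fintype ι) (w : ι → ℝ) (t : ι → σ), (∀ i, 0 ≤ w i) ∧ (∀ i, Inv (t i)) ∧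
      ∀ Φ : σ → ℝ, T.run step Φ s = ∑ i, w i * Φ (t i) := by
  induction T generalizing s with
  | leaf => exact ⟨Unit, inferInstance, fun _ => 1, fun _ => s, fun _ => zero_le_one, fun _ => hs,
      fun Φ => by simp [run]⟩
  | node ε z l r ihl ihr =>
    obtain ⟨h1, h2⟩ := hInv ε hT.1 z s hs
    obtain ⟨ι, _, w, t, hw, ht, hΦ⟩ := ihl hT.2.1 h1
    obtain ⟨ι', _, w', t', hw', ht', hΦ'⟩ := ihr hT.2.2 h2
    refine ⟨ι ⊕ ι', inferInstance, Sum.elim (fun i => w i / 2) (fun i => w' i / 2), Sum.elim t t',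
      ?_, ?_, fun Φ => ?_⟩
    · rintro (i | i)
      · exact div_nonneg (hw i) zero_le_two
      · exact div_nonneg (hw' i) zero_le_two
    · rintro (i | i)
      · simpa using ht i
      · simpa using ht' i
    · simp only [run, hΦ, hΦ', Fintype.sum_sum_type, Sum.elim_inl, Sum.elim_inr, add_div,
        Finset.sum_div]
      congr 1 <;> exact Finset.sum_congr rfl fun i _ => by ring

theorem run_le_run (hInv : ∀ ε ∈ A, ∀ z s, Inv s → Inv (step ε z s).1 ∧ Inv (step ε z s).2)
    {Φ Ψ : σ → ℝ} (h : ∀ s, Inv s → Φ s ≤ Ψ s) {T : WalshTree 𝕜 X} (hT : T.CoeffIn A) {s : σ}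
    (hs : Inv s) : T.run step Φ s ≤ T.run step Ψ s := by
  obtain ⟨ι, _, w, t, hw, ht, hΦ⟩ := exists_leaves hInv hT hs
  rw [hΦ, hΦ]
  exact Finset.sum_le_sum fun i _ => mul_le_mul_of_nonneg_left (h _ (ht i)) (hw i)

theorem run_le_of_supermartingale
    (hInv : ∀ ε ∈ A, ∀ z s, Inv s → Inv (step ε z s).1 ∧ Inv (step ε z s).2) {Φ : σ → ℝ}
    (h : ∀ ε ∈ A, ∀ z s, Inv s → (Φ (step ε z s).1 + Φ (step ε z s).2) / 2 ≤ Φ s)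
    {T : WalshTree 𝕜 X} (hT : T.CoeffIn A) {s : σ} (hs : Inv s) : T.run step Φ s ≤ Φ s := by
  induction T generalizing s with
  | leaf => exact le_rfl
  | node ε z l r ihl ihr =>
    obtain ⟨h1, h2⟩ := hInv ε hT.1 z s hs
    refine le_trans ?_ (h ε hT.1 z s hs)
    simp only [run]
    linarith [ihl hT.2.1 h1, ihr hT.2.2 h2]

theorem run_const (c : ℝ) (T : WalshTree 𝕜 X) (s : σ) : T.run step (fun _ => c) s = c := by
  induction T generalizing s with
  | leaf => rfl
  | node ε z l r ihl ihr => simp [run, ihl, ihr]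

theorem run_eq_of_inv (hInv : ∀ ε ∈ A, ∀ z s, Inv s → Inv (step ε z s).1 ∧ Inv (step ε z s).2)
    {Φ : σ → ℝ} {c : ℝ} (h : ∀ s, Inv s → Φ s = c) {T : WalshTree 𝕜 X} (hT : T.CoeffIn A) {s : σ}
    (hs : Inv s) : T.run step Φ s = c := by
  refine le_antisymm ?_ ?_
  · exact (run_le_run (Ψ := fun _ => c) hInv (fun s hs => (h s hs).le) hT hs).trans_eq
      (run_const c T s)
  · exact (run_const c T s).symm.trans_le
      (run_le_run (Φ := fun _ => c) hInv (fun s hs => (h s hs).ge) hT hs)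

end Run

section Maximal

variable {𝕜 : Type u} [RCLike 𝕜] {X : Type v} [NormedAddCommGroup X] [NormedSpace 𝕜 X]

/-- The step of the walk and its transform, together with the predictable maximal function of the
walk and the maximal function of the transform. -/
noncomputable def maximalStep (ε : 𝕜) (z : X) (s : (X × X) × ℝ × ℝ) :
    ((X × X) × ℝ × ℝ) × ((X × X) × ℝ × ℝ) :=
  (((s.1.1 + z, s.1.2 + ε • z), max s.2.1 (max ‖s.1.1 + z‖ ‖s.1.1 - z‖),
      max s.2.2 ‖s.1.2 + ε • z‖),
    ((s.1.1 - z, s.1.2 - ε • z), max s.2.1 (max ‖s.1.1 + z‖ ‖s.1.1 - z‖),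
      max s.2.2 ‖s.1.2 - ε • z‖))

theorem mean_eq_run_maximalStep (Φ : X × X → ℝ) (T : WalshTree 𝕜 X) (s : (X × X) × ℝ × ℝ) :
    T.mean Φ s.1 = T.run maximalStep (fun t => Φ t.1) s := by
  induction T generalizing s with
  | leaf => rfl
  | node ε z l r ihl ihr =>
    simp only [mean, run] at ihl ihr ⊢
    rw [← ihl, ← ihr]
    rfl

/-- Doob's inequality for the predictable maximal function. -/
theorem run_maximal_rpow_le {q : ℝ} (hq : 1 < q) (T : WalshTree 𝕜 X) (x y : X) (b : ℝ) :
    T.run maximalStep (fun t => t.2.1 ^ q) ((x, y), ‖x‖, b) ≤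
      (4 * q / (q - 1)) ^ q * T.run maximalStep (fun t => ‖t.1.1‖ ^ q) ((x, y), ‖x‖, b) := by
  have hq1 : 0 < q - 1 := by linarith
  -- This is twice Doob's constant: the mean of `‖x + z‖` and `‖x - z‖` is only known to be at least
  -- half of their maximum.
  set c := 2 * q / (q - 1) with hc
  have hc0 : 0 < c := by positivity
  have hc1 : 1 ≤ c := by rw [hc, le_div_iff₀ hq1]; linarith
  have hInv : ∀ ε ∈ (Set.univ : Set 𝕜), ∀ (z : X) (s : (X × X) × ℝ × ℝ), ‖s.1.1‖ ≤ s.2.1 →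
      ‖(maximalStep ε z s).1.1.1‖ ≤ (maximalStep ε z s).1.2.1 ∧
      ‖(maximalStep ε z s).2.1.1‖ ≤ (maximalStep ε z s).2.2.1 := by
    intro ε _ z s _
    simp [maximalStep]
  -- With `a` the maximal function, `a ^ q - c a ^ (q - 1) ‖x‖` is a supermartingale along the walk,
  -- and it starts at `(1 - c) ‖x‖ ^ q ≤ 0`.
  have key : T.run maximalStep (fun t => t.2.1 ^ q - c * t.2.1 ^ (q - 1) * ‖t.1.1‖)
      ((x, y), ‖x‖, b) ≤ 0 := by
    refine (run_le_of_supermartingale (Inv := fun s => ‖s.1.1‖ ≤ s.2.1) hInv ?_ T.coeffIn_univ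
      (le_refl ‖x‖)).trans ?_
    · rintro ε - z ⟨⟨x, y⟩, a, b⟩ hs
      simp only at hs
      simp only [maximalStep]
      have ha : 0 ≤ a := (norm_nonneg _).trans hs
      have hN : 2 * ‖x‖ ≤ ‖x + z‖ + ‖x - z‖ := by
        calc 2 * ‖x‖ = ‖(2 : 𝕜) • x‖ := by rw [norm_smul, RCLike.norm_ofNat]
          _ = ‖(x + z) + (x - z)‖ := by rw [two_smul]; congr 1; abel
          _ ≤ _ := norm_add_le _ _
      rcases le_total (max ‖x + z‖ ‖x - z‖) a with h | h
      · rw [max_eq_left h]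
        have : 0 ≤ c * a ^ (q - 1) := by positivity
        nlinarith
      · rw [max_eq_right h]
        set m := max ‖x + z‖ ‖x - z‖
        have hm0 : 0 ≤ m := ha.trans h
        have hm : m ≤ ‖x + z‖ + ‖x - z‖ :=
          max_le (by linarith [norm_nonneg (x - z)]) (by linarith [norm_nonneg (x + z)])
        have hmono : a ^ (q - 1) ≤ m ^ (q - 1) := Real.rpow_le_rpow ha h hq1.le
        have ha' : a * a ^ (q - 1) = a ^ q := by
          rcases ha.eq_or_lt with rfl | ha
          · rw [zero_mul, Real.zero_rpow (by linarith)]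
          · rw [← Real.rpow_one_add' ha.le (by linarith)]; congr 1; ring
        have hm' : m * m ^ (q - 1) = m ^ q := by
          rw [← Real.rpow_one_add' hm0 (by linarith)]; congr 1; ring
        have young : q * (m * a ^ (q - 1)) ≤ (q - 1) * a ^ q + m ^ q := by
          have hpq : (q / (q - 1)).HolderConjugate q := by
            rw [Real.holderConjugate_iff]
            refine ⟨by rw [one_lt_div hq1]; linarith, ?_⟩
            field_simp
            ring
          have := Real.young_inequality_of_nonneg (Real.rpow_nonneg ha (q - 1)) hm0 hpq
          rw [← Real.rpow_mul ha, mul_div_cancel₀ _ hq1.ne'] at this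
          have h2 := mul_le_mul_of_nonneg_left this (by linarith : 0 ≤ q)
          have h3 : q * (a ^ q / (q / (q - 1)) + m ^ q / q) = (q - 1) * a ^ q + m ^ q := by
            field_simp
          linarith
        have h1 : m ^ q - a ^ q ≤ c * (m / 2) * (m ^ (q - 1) - a ^ (q - 1)) := by
          have : c * (m / 2) * (m ^ (q - 1) - a ^ (q - 1)) =
              (q * (m * m ^ (q - 1)) - q * (m * a ^ (q - 1))) / (q - 1) := by
            rw [hc]; field_simp
          rw [this, le_div_iff₀ hq1, hm']
          linarith
        have h2 : 0 ≤ c * a ^ (q - 1) := by positivity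
        have h3 : 0 ≤ c * (m ^ (q - 1) - a ^ (q - 1)) := mul_nonneg hc0.le (by linarith)
        nlinarith
    · have e : ‖x‖ ^ (q - 1) * ‖x‖ = ‖x‖ ^ q := by
        rw [mul_comm, ← Real.rpow_one_add' (norm_nonneg x) (by linarith)]; congr 1; ring
      simp only
      rw [mul_assoc, e]
      have := Real.rpow_nonneg (norm_nonneg x) q
      nlinarith
  obtain ⟨ι, _, w, t, hw, ht, hΦ⟩ := exists_leaves
    (Inv := fun s : (X × X) × ℝ × ℝ => ‖s.1.1‖ ≤ s.2.1) hInv T.coeffIn_univ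
    (s := ((x, y), ‖x‖, b)) (le_refl ‖x‖)
  rw [hΦ] at key
  rw [hΦ, hΦ]
  -- Absorption: `c a ^ (q - 1) ‖x‖` is at most half of `a ^ q + (2 c ‖x‖) ^ q`, by comparing `a`
  -- with `2 c ‖x‖`. Note that `4 q / (q - 1) = 2 c`.
  have pt : ∀ i, w i * (t i).2.1 ^ q - (4 * q / (q - 1)) ^ q * (w i * ‖(t i).1.1‖ ^ q) ≤
      2 * (w i * ((t i).2.1 ^ q - c * (t i).2.1 ^ (q - 1) * ‖(t i).1.1‖)) := by
    intro i
    have hti := ht i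
    have hwi := hw i
    generalize t i = s at hti ⊢
    obtain ⟨⟨x, y⟩, a, b⟩ := s
    simp only at hti ⊢
    have hx := norm_nonneg x
    have e1 : 4 * q / (q - 1) = 2 * c := by rw [hc]; ring
    rw [e1]
    have ha : 0 ≤ a := hx.trans hti
    have h1 : c * a ^ (q - 1) * ‖x‖ ≤ a ^ q / 2 + (2 * c) ^ q * ‖x‖ ^ q / 2 := by
      rw [← Real.mul_rpow (by positivity) hx]
      rcases le_total (2 * c * ‖x‖) a with h | h
      · have : a ^ (q - 1) * a = a ^ q := by
          rw [mul_comm, ← Real.rpow_one_add' ha (by linarith)]; congr 1; ring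
        have h2 : 0 ≤ a ^ (q - 1) := by positivity
        have h3 : 0 ≤ (2 * c * ‖x‖) ^ q := by positivity
        nlinarith
      · have h2 : a ^ (q - 1) ≤ (2 * c * ‖x‖) ^ (q - 1) := Real.rpow_le_rpow ha h hq1.le
        have : (2 * c * ‖x‖) ^ (q - 1) * (2 * c * ‖x‖) = (2 * c * ‖x‖) ^ q := by
          rw [mul_comm, ← Real.rpow_one_add' (by positivity) (by linarith)]; congr 1; ring
        have h3 : 0 ≤ a ^ q := by positivity
        have h4 : 0 ≤ c * ‖x‖ := by positivity
        nlinarith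
    nlinarith
  have := Finset.sum_le_sum fun i (_ : i ∈ Finset.univ) => pt i
  rw [Finset.sum_sub_distrib, ← Finset.mul_sum, ← Finset.mul_sum] at this
  linarith

end Maximal

end WalshTree

/-! ### Good-λ inequalities and change of exponent -/

/-- The layer-cake formula at a single value; it turns distributional inequalities into moment
inequalities. -/
theorem integrableOn_and_setIntegral_rpow_mul_indicator {q c d : ℝ} (hq : 0 < q) (hc : 0 ≤ c)
    (hd : 0 < d) :
    IntegrableOn (fun t : ℝ => t ^ (q - 1) * if d * t < c then 1 else 0) (Set.Ioi 0) ∧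
      ∫ t in Set.Ioi (0 : ℝ), (t ^ (q - 1) * if d * t < c then 1 else 0) = (c / d) ^ q / q := by
  have e : (fun t : ℝ => t ^ (q - 1) * if d * t < c then 1 else 0) =
      (Set.Iio (c / d)).indicator fun t => t ^ (q - 1) := by
    ext t
    by_cases h : d * t < c
    · rw [if_pos h, mul_one, Set.indicator_of_mem]
      rwa [Set.mem_Iio, lt_div_iff₀ hd, mul_comm]
    · rw [if_neg h, mul_zero, Set.indicator_of_notMem]
      rwa [Set.mem_Iio, lt_div_iff₀ hd, mul_comm]
  have hcd : 0 ≤ c / d := by positivity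
  have e2 : Set.Ioi (0 : ℝ) ∩ Set.Iio (c / d) = Set.Ioo 0 (c / d) := rfl
  rw [e]
  constructor
  · rw [IntegrableOn, integrable_indicator_iff measurableSet_Iio, IntegrableOn,
      Measure.restrict_restrict measurableSet_Iio, Set.inter_comm, e2]
    have := (intervalIntegral.intervalIntegrable_rpow' (a := 0) (b := c / d)
      (r := q - 1) (by linarith)).1
    exact this.mono_set Set.Ioo_subset_Ioc_self
  · rw [setIntegral_indicator measurableSet_Iio, e2, ← integral_Ioc_eq_integral_Ioo,
      ← intervalIntegral.integral_of_le hcd, integral_rpow (Or.inl (by linarith))]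
    rw [sub_add_cancel, Real.zero_rpow hq.ne', sub_zero]

namespace WalshTree

section GoodLambda

variable {𝕜 : Type u} [RCLike 𝕜] {X : Type v} [NormedAddCommGroup X] [NormedSpace 𝕜 X]
  {p B : ℝ} {A : Set 𝕜}

/-- While the predictable maximum is at most `δ t`, the right-hand side dominates `‖y - y₀‖ ^ p`. It
is thus nonnegative, and at least `t ^ p` once `‖y‖ > 3 t`, because `‖y₀‖ ≤ 2 t`. Being midpoint
concave along the walk, it majorizes the exceedance probability. The alternative in `hb` says that
level `3 t` has not been passed before the current position. -/
theorem run_exceed_le_burkholderFun (hp : 0 < p) (hB : 0 ≤ B) (hU : WalshUMD 𝕜 X p A B)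
    (hA : A.Nontrivial) {δ t : ℝ} (ht : 0 < t) {x₀ y₀ : X}
    (hx₀ : ‖x₀‖ ≤ δ * t) (hy₀ : ‖y₀‖ ≤ 2 * t) {T : WalshTree 𝕜 X} (hT : T.CoeffIn A)
    {x y : X} {a b : ℝ} (hxa : ‖x‖ ≤ a) (ha : a ≤ δ * t) (hb : b ≤ 3 * t ∨ b = ‖y‖) :
    t ^ p * T.run maximalStep (fun s => if 3 * t < s.2.2 ∧ s.2.1 ≤ δ * t then 1 else 0)
        ((x, y), a, b) ≤
      burkholderFun p A B (x - x₀, y - y₀) + B * (2 * (δ * t)) ^ p := by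
  have htp : 0 < t ^ p := by positivity
  have hδ : 0 ≤ δ * t := (norm_nonneg x₀).trans hx₀
  have hle1 : ∀ (T : WalshTree 𝕜 X) (s : (X × X) × ℝ × ℝ),
      T.run maximalStep (fun s => if 3 * t < s.2.2 ∧ s.2.1 ≤ δ * t then 1 else 0) s ≤ 1 := by
    intro T s
    refine (run_le_run (A := Set.univ) (Inv := fun _ => True) (Ψ := fun _ => 1)
      (fun _ _ _ _ _ => ⟨trivial, trivial⟩) (fun s _ => ?_) T.coeffIn_univ trivial).trans_eq
      (run_const 1 T s)
    split_ifs <;> norm_num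
  have hlow : ∀ x y : X, ‖x‖ ≤ δ * t →
      ‖y - y₀‖ ^ p ≤ burkholderFun p A B (x - x₀, y - y₀) + B * (2 * (δ * t)) ^ p := by
    intro x y hx
    have h1 := powGain_le_burkholderFun hU hA (x - x₀, y - y₀)
    have h2 : ‖x - x₀‖ ^ p ≤ (2 * (δ * t)) ^ p :=
      Real.rpow_le_rpow (norm_nonneg _) ((norm_sub_le _ _).trans (by linarith)) hp.le
    have h3 := mul_le_mul_of_nonneg_left h2 hB
    simp only [powGain] at h1
    linarith
  have hbig : ∀ (T : WalshTree 𝕜 X) (x y : X) (a : ℝ), ‖x‖ ≤ δ * t → 3 * t < ‖y‖ →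
      t ^ p * T.run maximalStep (fun s => if 3 * t < s.2.2 ∧ s.2.1 ≤ δ * t then 1 else 0)
        ((x, y), a, ‖y‖) ≤ burkholderFun p A B (x - x₀, y - y₀) + B * (2 * (δ * t)) ^ p := by
    intro T x y a hx hy
    refine le_trans ?_ (hlow x y hx)
    have h1 : t ^ p ≤ ‖y - y₀‖ ^ p := by
      refine Real.rpow_le_rpow ht.le ?_ hp.le
      have := norm_sub_norm_le y y₀
      linarith
    nlinarith [hle1 T ((x, y), a, ‖y‖)]
  induction T generalizing x y a b with
  | leaf =>
    rcases le_or_gt b (3 * t) with h | h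
    · have := hlow x y (hxa.trans ha)
      simp only [run]
      rw [if_neg (by intro h'; linarith [h'.1])]
      have h2 : 0 ≤ ‖y - y₀‖ ^ p := by positivity
      linarith
    · rcases hb with hb | rfl
      · linarith
      · exact hbig _ x y a (hxa.trans ha) h
  | node ε z l r ihl ihr =>
    rcases lt_or_ge (3 * t) b with h | h
    · rcases hb with hb | rfl
      · linarith
      · exact hbig _ x y a (hxa.trans ha) h
    rcases lt_or_ge (δ * t) (max a (max ‖x + z‖ ‖x - z‖)) with hm | hm
    · have hz : ∀ (T : WalshTree 𝕜 X) (s : (X × X) × ℝ × ℝ), δ * t < s.2.1 →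
          T.run maximalStep (fun s => if 3 * t < s.2.2 ∧ s.2.1 ≤ δ * t then (1 : ℝ) else 0) s
            = 0 := by
        intro T s hs
        refine run_eq_of_inv (A := Set.univ) (Inv := fun s => δ * t < s.2.1) ?_ ?_ T.coeffIn_univ hs
        · intro ε _ z s hs
          simp only [maximalStep]
          exact ⟨lt_max_of_lt_left hs, lt_max_of_lt_left hs⟩
        · intro s hs
          rw [if_neg (fun h' => by linarith [h'.2])]
      simp only [run]
      rw [hz, hz]
      · have := hlow x y (hxa.trans ha)
        have h2 : 0 ≤ ‖y - y₀‖ ^ p := by positivity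
        linarith
      · exact hm
      · exact hm
    · have hb' : ∀ y' : X, max b ‖y'‖ ≤ 3 * t ∨ max b ‖y'‖ = ‖y'‖ := by
        intro y'
        rcases le_total b ‖y'‖ with h' | h'
        · right; exact max_eq_right h'
        · left; rw [max_eq_left h']; exact h
      have h1 := ihl hT.2.1 (x := x + z) (y := y + ε • z)
        ((le_max_left _ _).trans (le_max_right a (max ‖x + z‖ ‖x - z‖))) hm (hb' _)
      have h2 := ihr hT.2.2 (x := x - z) (y := y - ε • z)
        ((le_max_right _ _).trans (le_max_right a (max ‖x + z‖ ‖x - z‖))) hm (hb' _)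
      have h3 := burkholderFun_midpoint hU hA hT.1 (x - x₀, y - y₀) z
      rw [Prod.mk_add_mk, Prod.mk_sub_mk, sub_add_eq_add_sub, sub_add_eq_add_sub,
        sub_right_comm x, sub_right_comm y] at h3
      simp only [run, maximalStep]
      linarith

/-- Stop when the transform first exceeds `t`. The predictable maximum bounds the step by `δ t ≤ t`,
so with coefficients of modulus at most one the transform lands within `2 t`. Restart with the
landing point as base point: Burkholder's function is nonpositive at the origin, so the conditional
probability is at most `B (2 δ) ^ p`. -/
theorem run_exceed_le (hp : 0 < p) (hB : 0 ≤ B) (hU : WalshUMD 𝕜 X p A B)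
    (hA : A.Nontrivial) (hA1 : ∀ ε ∈ A, ‖ε‖ ≤ 1) {δ t : ℝ} (ht : 0 < t) (hδ : 0 ≤ δ) (hδ1 : δ ≤ 1)
    {T : WalshTree 𝕜 X} (hT : T.CoeffIn A) {x y : X} {a b : ℝ} (hxa : ‖x‖ ≤ a) (hyb : ‖y‖ ≤ b)
    (hb : b ≤ t) :
    T.run maximalStep (fun s => if 3 * t < s.2.2 ∧ s.2.1 ≤ δ * t then 1 else 0) ((x, y), a, b) ≤
      B * (2 * δ) ^ p *
        T.run maximalStep (fun s => if t < s.2.2 then 1 else 0) ((x, y), a, b) := by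
  have htp : 0 < t ^ p := by positivity
  have hone : ∀ (T : WalshTree 𝕜 X) (s : (X × X) × ℝ × ℝ), t < s.2.2 →
      T.run maximalStep (fun s => if t < s.2.2 then (1 : ℝ) else 0) s = 1 := by
    intro T s hs
    refine run_eq_of_inv (A := Set.univ) (Inv := fun s => t < s.2.2) ?_ ?_ T.coeffIn_univ hs
    · intro ε _ z s hs
      simp only [maximalStep]
      exact ⟨lt_max_of_lt_left hs, lt_max_of_lt_left hs⟩
    · intro s hs
      rw [if_pos hs]
  have hU0 : burkholderFun p A B ((0, 0) : X × X) ≤ 0 := by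
    obtain ⟨α, hα⟩ := hA.nonempty
    simpa using burkholderFun_diag_nonpos hU (0 : X) hα
  induction T generalizing x y a b with
  | leaf =>
    simp only [run]
    rw [if_neg (by intro h'; linarith [h'.1]), if_neg (by linarith), mul_zero]
  | node ε z l r ihl ihr =>
    rcases lt_or_ge (δ * t) (max a (max ‖x + z‖ ‖x - z‖)) with hm | hm
    · have hz : ∀ (T : WalshTree 𝕜 X) (s : (X × X) × ℝ × ℝ), δ * t < s.2.1 →
          T.run maximalStep (fun s => if 3 * t < s.2.2 ∧ s.2.1 ≤ δ * t then (1 : ℝ) else 0) s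
            = 0 := by
        intro T s hs
        refine run_eq_of_inv (A := Set.univ) (Inv := fun s => δ * t < s.2.1) ?_ ?_ T.coeffIn_univ hs
        · intro ε _ z s hs
          simp only [maximalStep]
          exact ⟨lt_max_of_lt_left hs, lt_max_of_lt_left hs⟩
        · intro s hs
          rw [if_neg (fun h' => by linarith [h'.2])]
      have hnn : ∀ (T : WalshTree 𝕜 X) (s : (X × X) × ℝ × ℝ), 0 ≤
          T.run maximalStep (fun s => if t < s.2.2 then (1 : ℝ) else 0) s := by
        intro T s
        refine (run_const 0 T s).symm.trans_le (run_le_run (A := Set.univ) (Inv := fun _ => True)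
          (fun _ _ _ _ _ => ⟨trivial, trivial⟩) (fun s _ => ?_) T.coeffIn_univ trivial)
        split_ifs <;> norm_num
      have := mul_nonneg (by positivity : 0 ≤ B * (2 * δ) ^ p) (hnn (node ε z l r) ((x, y), a, b))
      refine le_trans (le_of_eq ?_) this
      simp only [run]
      rw [hz, hz]
      · simp
      · exact hm
      · exact hm
    · have hxz1 : ‖x + z‖ ≤ max a (max ‖x + z‖ ‖x - z‖) :=
        (le_max_left _ _).trans (le_max_right _ _)
      have hxz2 : ‖x - z‖ ≤ max a (max ‖x + z‖ ‖x - z‖) :=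
        (le_max_right _ _).trans (le_max_right _ _)
      have hz : ‖z‖ ≤ t := by
        have : 2 * ‖z‖ ≤ ‖x + z‖ + ‖x - z‖ := by
          calc 2 * ‖z‖ = ‖(2 : 𝕜) • z‖ := by rw [norm_smul, RCLike.norm_ofNat]
            _ = ‖(x + z) - (x - z)‖ := by rw [two_smul]; congr 1; abel
            _ ≤ _ := norm_sub_le _ _
        nlinarith
      have hεz : ‖ε • z‖ ≤ t := by
        rw [norm_smul]
        have := hA1 ε hT.1
        nlinarith [norm_nonneg z]
      have child : ∀ (T : WalshTree 𝕜 X), T.CoeffIn A → ∀ (x' y' : X) (a' : ℝ), ‖x'‖ ≤ a' →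
          a' ≤ δ * t → ‖y'‖ ≤ 2 * t → t < max b ‖y'‖ →
          T.run maximalStep (fun s => if 3 * t < s.2.2 ∧ s.2.1 ≤ δ * t then 1 else 0)
            ((x', y'), a', max b ‖y'‖) ≤ B * (2 * δ) ^ p *
          T.run maximalStep (fun s => if t < s.2.2 then 1 else 0) ((x', y'), a', max b ‖y'‖) := by
        intro T hT x' y' a' hx' ha' hy' hlt
        rw [hone _ _ hlt, mul_one]
        have hbe : max b ‖y'‖ = ‖y'‖ := by
          rcases lt_max_iff.1 hlt with h | h
          · linarith
          · exact max_eq_right (by linarith)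
        have := run_exceed_le_burkholderFun hp hB hU hA ht (hx'.trans ha') hy' hT hx' ha'
          (Or.inr hbe)
        rw [sub_self, sub_self, ← mul_assoc, Real.mul_rpow (by positivity) ht.le] at this
        have h2 : t ^ p * _ ≤ t ^ p * (B * (2 * δ) ^ p) := this.trans (by linarith)
        exact le_of_mul_le_mul_left h2 htp
      have hy1 : ‖y + ε • z‖ ≤ 2 * t := (norm_add_le _ _).trans (by linarith)
      have hy2 : ‖y - ε • z‖ ≤ 2 * t := (norm_sub_le _ _).trans (by linarith)
      have h1 : l.run maximalStep (fun s => if 3 * t < s.2.2 ∧ s.2.1 ≤ δ * t then 1 else 0)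
          (maximalStep ε z ((x, y), a, b)).1 ≤ B * (2 * δ) ^ p *
          l.run maximalStep (fun s => if t < s.2.2 then 1 else 0)
            (maximalStep ε z ((x, y), a, b)).1 := by
        rcases lt_or_ge t (max b ‖y + ε • z‖) with h | h
        · exact child l hT.2.1 _ _ _ hxz1 hm hy1 h
        · exact ihl hT.2.1 hxz1 (le_max_right _ _) h
      have h2 : r.run maximalStep (fun s => if 3 * t < s.2.2 ∧ s.2.1 ≤ δ * t then 1 else 0)
          (maximalStep ε z ((x, y), a, b)).2 ≤ B * (2 * δ) ^ p *
          r.run maximalStep (fun s => if t < s.2.2 then 1 else 0)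
            (maximalStep ε z ((x, y), a, b)).2 := by
        rcases lt_or_ge t (max b ‖y - ε • z‖) with h | h
        · exact child r hT.2.2 _ _ _ hxz2 hm hy2 h
        · exact ihr hT.2.2 hxz2 (le_max_right _ _) h
      simp only [run]
      linarith

end GoodLambda

end WalshTree

/-- Extrapolation: the UMD inequality for dyadic walks for one exponent implies it for every
exponent. -/
theorem WalshUMD.extrapolate {𝕜 : Type u} [RCLike 𝕜] {X : Type v} [NormedAddCommGroup X]
    [NormedSpace 𝕜 X] {p B : ℝ} {A : Set 𝕜} (hp : 0 < p) (hB : 0 ≤ B) (hU : WalshUMD 𝕜 X p A B)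
    (hA : A.Nontrivial) (hA1 : ∀ ε ∈ A, ‖ε‖ ≤ 1) {q : ℝ} (hq : 1 < q) :
    ∃ C, 0 ≤ C ∧ WalshUMD 𝕜 X q A C := by
  have hq0 : 0 < q := by linarith
  have hq1 : 0 < q - 1 := by linarith
  -- Integrating the good-λ inequality multiplies the left side by `(1 / 3) ^ q`; half of this has
  -- to absorb the last term.
  obtain ⟨δ, hδ0, hδ1, hκ⟩ : ∃ δ : ℝ, 0 < δ ∧ δ ≤ 1 ∧ B * (2 * δ) ^ p ≤ (1 / 3) ^ q / 2 := by
    set η : ℝ := (1 / 3) ^ q / 2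
    have hη : 0 < η := by positivity
    refine ⟨min 1 ((η / (B + 1)) ^ p⁻¹ / 2), by positivity, min_le_left _ _, ?_⟩
    have h1 : (2 * min 1 ((η / (B + 1)) ^ p⁻¹ / 2)) ^ p ≤ η / (B + 1) := by
      calc (2 * min 1 ((η / (B + 1)) ^ p⁻¹ / 2)) ^ p ≤ ((η / (B + 1)) ^ p⁻¹) ^ p := by
            refine Real.rpow_le_rpow (by positivity) ?_ hp.le
            have := min_le_right 1 ((η / (B + 1)) ^ p⁻¹ / 2)
            linarith
        _ = η / (B + 1) := Real.rpow_inv_rpow (by positivity) hp.ne'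
    calc B * _ ≤ B * (η / (B + 1)) := mul_le_mul_of_nonneg_left h1 hB
      _ = (B / (B + 1)) * η := by ring
      _ ≤ 1 * η := by
        refine mul_le_mul_of_nonneg_right ?_ hη.le
        rw [div_le_one (by positivity)]; linarith
      _ = η := one_mul η
  refine ⟨2 * 3 ^ q * ((1 / δ) ^ q * (4 * q / (q - 1)) ^ q), by positivity,
    fun T hT x ε hε => ?_⟩
  set κ := B * (2 * δ) ^ p
  have hy : ‖ε • x‖ ≤ ‖x‖ := by
    rw [norm_smul]
    exact mul_le_of_le_one_left (norm_nonneg _) (hA1 ε hε)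
  set y := ε • x
  set s₀ : (X × X) × ℝ × ℝ := ((x, y), ‖x‖, ‖y‖)
  have hInv : ∀ ε ∈ A, ∀ (z : X) (s : (X × X) × ℝ × ℝ), (‖s.1.2‖ ≤ s.2.2 ∧ ‖x‖ ≤ s.2.1) →
      (‖(WalshTree.maximalStep ε z s).1.1.2‖ ≤ (WalshTree.maximalStep ε z s).1.2.2 ∧
        ‖x‖ ≤ (WalshTree.maximalStep ε z s).1.2.1) ∧
      (‖(WalshTree.maximalStep ε z s).2.1.2‖ ≤ (WalshTree.maximalStep ε z s).2.2.2 ∧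
        ‖x‖ ≤ (WalshTree.maximalStep ε z s).2.2.1) := by
    intro ε _ z s hs
    simp only [WalshTree.maximalStep]
    exact ⟨⟨le_max_right _ _, le_max_of_le_left hs.2⟩, ⟨le_max_right _ _, le_max_of_le_left hs.2⟩⟩
  have hs₀ : ‖s₀.1.2‖ ≤ s₀.2.2 ∧ ‖x‖ ≤ s₀.2.1 := ⟨le_rfl, le_rfl⟩
  obtain ⟨ι, _, w, t, hw, ht, hΦ⟩ := WalshTree.exists_leaves
    (Inv := fun s : (X × X) × ℝ × ℝ => ‖s.1.2‖ ≤ s.2.2 ∧ ‖x‖ ≤ s.2.1) hInv hT hs₀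
  have ha0 : ∀ i, 0 ≤ (t i).2.1 := fun i => (norm_nonneg x).trans (ht i).2
  have hb0 : ∀ i, 0 ≤ (t i).2.2 := fun i => (norm_nonneg _).trans (ht i).1
  have hκ0 : 0 ≤ κ := by positivity
  -- If the transform starts above level `l`, then `‖x‖ ≥ ‖y‖ > l ≥ δ l`, and the first sum on the
  -- right is the total mass.
  have good : ∀ l : ℝ, 0 < l → ∑ i, w i * (if 3 * l < (t i).2.2 then 1 else 0) ≤
      (∑ i, w i * if δ * l < (t i).2.1 then 1 else 0) +
        κ * ∑ i, w i * if 1 * l < (t i).2.2 then 1 else 0 := by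
    intro l hl
    simp only [one_mul]
    rcases le_or_gt ‖y‖ l with hyl | hyl
    · have h := WalshTree.run_exceed_le hp hB hU hA hA1 hl hδ0.le hδ1 hT (le_refl ‖x‖) (le_refl ‖y‖) hyl
      rw [hΦ, hΦ] at h
      refine le_trans ?_ (add_le_add_right h _)
      rw [← Finset.sum_add_distrib]
      refine Finset.sum_le_sum fun i _ => ?_
      rw [← mul_add]
      refine mul_le_mul_of_nonneg_left ?_ (hw i)
      by_cases h1 : 3 * l < (t i).2.2 <;> by_cases h2 : δ * l < (t i).2.1
      · simp [h1, h2, not_le.2 h2]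
      · simp [h1, h2, not_lt.1 h2]
      · simp [h1, h2]
      · simp [h1, h2]
    · refine le_add_of_le_of_nonneg (Finset.sum_le_sum fun i _ =>
        mul_le_mul_of_nonneg_left ?_ (hw i)) (mul_nonneg hκ0 (Finset.sum_nonneg fun i _ =>
          mul_nonneg (hw i) (by split_ifs <;> norm_num)))
      rw [if_pos (show δ * l < (t i).2.1 by nlinarith [(ht i).2])]
      split_ifs <;> norm_num
  have int : ∀ {d : ℝ}, 0 < d → ∀ c : ι → ℝ, (∀ i, 0 ≤ c i) →
      IntegrableOn (fun l : ℝ => l ^ (q - 1) * ∑ i, w i * if d * l < c i then 1 else 0)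
        (Set.Ioi 0) ∧
      ∫ l in Set.Ioi (0 : ℝ), (l ^ (q - 1) * ∑ i, w i * if d * l < c i then 1 else 0) =
        (1 / d) ^ q / q * ∑ i, w i * c i ^ q := by
    intro d hd c hc
    have e : (fun l : ℝ => l ^ (q - 1) * ∑ i, w i * if d * l < c i then 1 else 0) =
        fun l : ℝ => ∑ i, w i * (l ^ (q - 1) * if d * l < c i then 1 else 0) := by
      ext l
      rw [Finset.mul_sum]
      exact Finset.sum_congr rfl fun i _ => by ring
    rw [e]
    constructor
    · exact integrable_finsetSum _ fun i _ =>
        (integrableOn_and_setIntegral_rpow_mul_indicator hq0 (hc i) hd).1.const_mul _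
    · rw [integral_finsetSum _ fun i _ =>
        (integrableOn_and_setIntegral_rpow_mul_indicator hq0 (hc i) hd).1.const_mul _,
        Finset.mul_sum]
      refine Finset.sum_congr rfl fun i _ => ?_
      rw [integral_const_mul, (integrableOn_and_setIntegral_rpow_mul_indicator hq0 (hc i) hd).2,
        Real.div_rpow (hc i) hd.le, Real.div_rpow zero_le_one hd.le, Real.one_rpow]
      ring
  have i1 := int three_pos (fun i => (t i).2.2) hb0
  have i2 := int hδ0 (fun i => (t i).2.1) ha0
  have i3 := int one_pos (fun i => (t i).2.2) hb0
  have ineq : (1 / 3) ^ q / q * ∑ i, w i * (t i).2.2 ^ q ≤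
      (1 / δ) ^ q / q * ∑ i, w i * (t i).2.1 ^ q +
        κ * ((1 / 1) ^ q / q * ∑ i, w i * (t i).2.2 ^ q) := by
    rw [← i1.2, ← i2.2, ← i3.2, ← integral_const_mul, ← integral_add i2.1 (i3.1.const_mul κ)]
    refine setIntegral_mono_on i1.1 (i2.1.add (i3.1.const_mul κ)) measurableSet_Ioi
      fun l hl => ?_
    have h := mul_le_mul_of_nonneg_left (good l hl) (Real.rpow_nonneg (le_of_lt hl) (q - 1))
    linarith
  have doob := WalshTree.run_maximal_rpow_le hq T x y ‖y‖
  rw [hΦ, hΦ] at doob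
  rw [WalshTree.mean_eq_run_maximalStep _ _ s₀, hΦ]
  have hfin : ∑ i, w i * ‖(t i).1.2‖ ^ q ≤ ∑ i, w i * (t i).2.2 ^ q :=
    Finset.sum_le_sum fun i _ => mul_le_mul_of_nonneg_left
      (Real.rpow_le_rpow (norm_nonneg _) (ht i).1 hq0.le) (hw i)
  have hsplit : ∀ C, ∑ i, w i * powGain q C (t i).1 =
      ∑ i, w i * ‖(t i).1.2‖ ^ q - C * ∑ i, w i * ‖(t i).1.1‖ ^ q := by
    intro C
    rw [Finset.mul_sum, ← Finset.sum_sub_distrib]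
    exact Finset.sum_congr rfl fun i _ => by unfold powGain; ring
  rw [hsplit]
  set Sb := ∑ i, w i * (t i).2.2 ^ q
  set Sa := ∑ i, w i * (t i).2.1 ^ q
  have hSb : 0 ≤ Sb := Finset.sum_nonneg fun i _ => mul_nonneg (hw i) (Real.rpow_nonneg (hb0 i) q)
  have h3 : (1 / 3 : ℝ) ^ q * Sb ≤ (1 / δ) ^ q * Sa + κ * Sb := by
    rw [div_one, Real.one_rpow] at ineq
    have := mul_le_mul_of_nonneg_left ineq hq0.le
    have e1 : q * ((1 / 3 : ℝ) ^ q / q * Sb) = (1 / 3 : ℝ) ^ q * Sb := by field_simp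
    have e2 : q * ((1 / δ) ^ q / q * Sa + κ * (1 / q * Sb)) = (1 / δ) ^ q * Sa + κ * Sb := by
      field_simp
    rw [e1, e2] at this
    exact this
  have h4 : (1 / 3 : ℝ) ^ q * Sb ≤ 2 * ((1 / δ) ^ q * Sa) := by nlinarith
  have h5 : (3 : ℝ) ^ q * (1 / 3) ^ q = 1 := by
    rw [← Real.mul_rpow (by norm_num) (by norm_num)]; norm_num
  have h6 : Sb ≤ 2 * 3 ^ q * ((1 / δ) ^ q * Sa) := by
    have h3q : (0 : ℝ) ≤ 3 ^ q := by positivity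
    calc Sb = 3 ^ q * ((1 / 3) ^ q * Sb) := by rw [← mul_assoc, h5, one_mul]
      _ ≤ 3 ^ q * (2 * ((1 / δ) ^ q * Sa)) := mul_le_mul_of_nonneg_left h4 h3q
      _ = _ := by ring
  have h7 : 2 * 3 ^ q * ((1 / δ) ^ q * Sa) ≤ 2 * 3 ^ q * ((1 / δ) ^ q *
      ((4 * q / (q - 1)) ^ q * ∑ i, w i * ‖(t i).1.1‖ ^ q)) := by
    gcongr
  have h8 : 2 * 3 ^ q * ((1 / δ) ^ q * ((4 * q / (q - 1)) ^ q * ∑ i, w i * ‖(t i).1.1‖ ^ q)) =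
    2 * 3 ^ q * ((1 / δ) ^ q * (4 * q / (q - 1)) ^ q) * ∑ i, w i * ‖(t i).1.1‖ ^ q := by ring
  linarith

/-! ### Jensen's inequality with a random coefficient -/

section OneStep

variable {𝕜 : Type u} [RCLike 𝕜] {X : Type v} [NormedAddCommGroup X] [NormedSpace 𝕜 X]
  {p C : ℝ} {A : Set 𝕜} {F : X × X → ℝ} {Ω : Type w} {m : MeasurableSpace Ω} {μ : Measure Ω}

theorem integrable_bound_of_memLp (hp : 0 < p) {h : Ω → ℝ} (hh : MemLp h (ENNReal.ofReal p) μ)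
    (C : ℝ) : Integrable (fun ω => C * |h ω| ^ p) μ := by
  have := hh.integrable_norm_rpow (by simpa using hp) ENNReal.ofReal_ne_top
  rw [ENNReal.toReal_ofReal hp.le] at this
  exact this.const_mul C

theorem abs_comp_le_of_norm_le (hp : 0 < p) (hC0 : 0 ≤ C) (hC : ∀ s, |F s| ≤ C * ‖s‖ ^ p)
    {s : X × X} {r : ℝ} (h : ‖s‖ ≤ r) : ‖F s‖ ≤ C * |r| ^ p :=
  (hC s).trans (mul_le_mul_of_nonneg_left
    (Real.rpow_le_rpow (norm_nonneg _) (h.trans (le_abs_self r)) hp.le) hC0)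

theorem integrable_comp_of_norm_le (hp : 0 < p) (hF : Continuous F) (hC0 : 0 ≤ C)
    (hC : ∀ s, |F s| ≤ C * ‖s‖ ^ p) {G : Ω → X × X} (hG : AEStronglyMeasurable G μ) {h : Ω → ℝ}
    (hh : MemLp h (ENNReal.ofReal p) μ) (hle : ∀ᵐ ω ∂μ, ‖G ω‖ ≤ h ω) :
    Integrable (fun ω => F (G ω)) μ :=
  (integrable_bound_of_memLp hp hh C).mono' (hF.comp_aestronglyMeasurable hG)
    (hle.mono fun _ hω => abs_comp_le_of_norm_le hp hC0 hC hω)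

theorem tendsto_integral_comp_of_norm_le (hp : 0 < p) (hF : Continuous F) (hC0 : 0 ≤ C)
    (hC : ∀ s, |F s| ≤ C * ‖s‖ ^ p) {G : ℕ → Ω → X × X} {G' : Ω → X × X}
    (hG : ∀ n, AEStronglyMeasurable (G n) μ) {h : Ω → ℝ}
    (hh : MemLp h (ENNReal.ofReal p) μ) (hle : ∀ n, ∀ᵐ ω ∂μ, ‖G n ω‖ ≤ h ω)
    (hlim : ∀ᵐ ω ∂μ, Tendsto (fun n => G n ω) atTop (𝓝 (G' ω))) :
    Tendsto (fun n => ∫ ω, F (G n ω) ∂μ) atTop (𝓝 (∫ ω, F (G' ω) ∂μ)) := by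
  refine tendsto_integral_of_dominated_convergence _
    (fun n => hF.comp_aestronglyMeasurable (hG n)) (integrable_bound_of_memLp hp hh C)
    (fun n => (hle n).mono fun _ hω => abs_comp_le_of_norm_le hp hC0 hC hω)
    (hlim.mono fun ω hω => (hF.tendsto _).comp hω)

theorem norm_add_smul_le (w : X × X) (c : 𝕜) (z : X) :
    ‖w + (z, c • z)‖ ≤ ‖w‖ + (1 + ‖c‖) * ‖z‖ := by
  refine (norm_add_le _ _).trans ?_
  gcongr
  refine max_le ?_ ?_
  · nlinarith [norm_nonneg c, norm_nonneg z]
  · simp only [norm_smul]; nlinarith [norm_nonneg c, norm_nonneg z]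

theorem memLp_const_add_mul_norm [IsFiniteMeasure μ] {Z : Ω → X} (hZ : MemLp Z (ENNReal.ofReal p) μ) (a b : ℝ) :
    MemLp (fun ω => a + b * ‖Z ω‖) (ENNReal.ofReal p) μ :=
  (memLp_const a).add (hZ.norm.const_mul b)

theorem integral_simpleFunc_apply {E : Type*} [NormedAddCommGroup E] [NormedSpace ℝ E]
    {β : Type*} (a : SimpleFunc Ω β) {G : β → Ω → E} (hG : ∀ c ∈ a.range, Integrable (G c) μ) :
    ∫ ω, G (a ω) ω ∂μ = ∑ c ∈ a.range, ∫ ω in a ⁻¹' {c}, G c ω ∂μ := by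
  have hS : ∀ c, MeasurableSet (a ⁻¹' {c}) := fun c => a.measurableSet_fiber c
  have hcover : ⋃ c ∈ a.range, a ⁻¹' {c} = Set.univ := by
    ext ω
    simp
  have heq : ∀ c, Set.EqOn (fun ω => G (a ω) ω) (G c) (a ⁻¹' {c}) := fun c ω hω => by
    rw [Set.mem_preimage, Set.mem_singleton_iff] at hω
    simp only [hω]
  rw [← setIntegral_univ, ← hcover, integral_biUnion_finset a.range (fun c _ => hS c)]
  · exact Finset.sum_congr rfl fun c _ => setIntegral_congr_fun (hS c) (heq c)
  · intro c _ d _ hcd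
    exact Disjoint.preimage _ (by simpa using hcd)
  · intro c hc
    exact (hG c hc).integrableOn.congr_fun (heq c).symm (hS c)

variable [NormedSpace ℝ X] [IsScalarTower ℝ 𝕜 X] [IsProbabilityMeasure μ]

theorem sub_le_mul_sub_of_concaveOn {ε : 𝕜}
    (hconc : ∀ s, ConcaveOn ℝ Set.univ fun z : X => F (s + (z, ε • z))) (w : X × X) (z : X)
    {s : ℝ} (hs0 : 0 ≤ s) (hs1 : s ≤ 1) :
    F w - F (w - s • (z, ε • z)) ≤ s * (F w - F (w - (z, ε • z))) := by
  have := (hconc w).2 (Set.mem_univ 0) (Set.mem_univ (-z)) (show 0 ≤ 1 - s by linarith) hs0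
    (by ring)
  simp only [smul_zero, zero_add, smul_eq_mul, smul_neg] at this
  rw [Prod.mk_zero_zero, add_zero, ← smul_comm s ε z, ← Prod.neg_mk, ← Prod.neg_mk,
    ← Prod.smul_mk, ← sub_eq_add_neg, ← sub_eq_add_neg] at this
  linarith

variable [CompleteSpace X]

/-- Jensen replaces `S.indicator Z` by its mean `e`; concavity at `-s • e`, `0`, `e` then bounds the
forward gain by the backward drop. Backward differences serve in place of derivatives, which need
not exist. -/
theorem setIntegral_sub_le_of_concaveOn (hp : 1 ≤ p) (hF : Continuous F) (hC0 : 0 ≤ C)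
    (hC : ∀ s, |F s| ≤ C * ‖s‖ ^ p) {ε : 𝕜}
    (hconc : ∀ s, ConcaveOn ℝ Set.univ fun z : X => F (s + (z, ε • z)))
    {Z : Ω → X} (hZ : MemLp Z (ENNReal.ofReal p) μ) {S : Set Ω} (hS : MeasurableSet S)
    (w : X × X) {s : ℝ} (hs : 0 < s) :
    s * ∫ ω in S, (F (w + (Z ω, ε • Z ω)) - F w) ∂μ ≤
      F w - F (w - s • (∫ ω in S, Z ω ∂μ, ε • ∫ ω in S, Z ω ∂μ)) := by
  have hp0 : 0 < p := by linarith
  set G : X → ℝ := fun z => F (w + (z, ε • z)) with hG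
  have hGc : Continuous G := hF.comp (by fun_prop)
  have hGconc := hconc w
  set e := ∫ ω in S, Z ω ∂μ
  have hG0 : G 0 = F w := by simp [hG, Prod.mk_zero_zero]
  have hZi : Integrable Z μ := hZ.integrable (by simpa using hp)
  have hGi : Integrable (fun ω => G (Z ω)) μ :=
    integrable_comp_of_norm_le hp0 hF hC0 hC
      ((aestronglyMeasurable_const).add (hZ.1.prodMk (hZ.1.const_smul ε)))
      (memLp_const_add_mul_norm hZ ‖w‖ (1 + ‖ε‖))
      (ae_of_all _ fun ω => norm_add_smul_le w ε (Z ω))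
  have hind : (fun ω => G (S.indicator Z ω)) =
      fun ω => S.indicator (fun ω => G (Z ω) - F w) ω + F w := by
    ext ω
    by_cases h : ω ∈ S
    · simp [h]
    · simp [h, hG0]
  have hint : Integrable (S.indicator fun ω => G (Z ω) - F w) μ :=
    (hGi.sub (integrable_const _)).indicator hS
  have jensen : ∫ ω, G (S.indicator Z ω) ∂μ ≤ G e := by
    have := hGconc.le_map_integral (μ := μ) (f := S.indicator Z) hGc.continuousOn isClosed_univ
      (ae_of_all _ fun _ => trivial) (hZi.indicator hS) (by
        change Integrable (fun ω => G (S.indicator Z ω)) μ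
        rw [hind]
        exact hint.add (integrable_const _))
    rwa [integral_indicator hS] at this
  rw [hind, integral_add hint (integrable_const _), integral_indicator hS, integral_const] at jensen
  simp only [probReal_univ, smul_eq_mul, one_mul] at jensen
  have conc := hGconc.2 (Set.mem_univ e) (Set.mem_univ (-(s • e)))
    (show 0 ≤ s / (1 + s) by positivity) (show 0 ≤ 1 / (1 + s) by positivity)
    (by rw [← add_div, add_comm, div_self (by positivity)])
  have e0 : (s / (1 + s)) • e + (1 / (1 + s)) • (-(s • e)) = 0 := by
    rw [smul_neg, smul_smul, ← sub_eq_add_neg, ← sub_smul]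
    convert zero_smul ℝ e using 2
    ring
  have e1 : F (w - s • (e, ε • e)) = G (-(s • e)) := by
    simp only [hG]
    congr 1
    rw [sub_eq_add_neg, Prod.smul_mk, Prod.neg_mk, smul_neg, smul_comm s ε e]
  rw [e1]
  simp only [smul_eq_mul] at conc
  rw [e0] at conc
  change s / (1 + s) * G e + 1 / (1 + s) * G (-(s • e)) ≤ G 0 at conc
  rw [hG0, div_mul_eq_mul_div, div_mul_eq_mul_div, ← add_div, div_le_iff₀ (by positivity)] at conc
  have := mul_le_mul_of_nonneg_left jensen hs.le
  change s * ∫ ω in S, (G (Z ω) - F w) ∂μ ≤ _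
  nlinarith

/-- Slopes in different zigzag directions at one point do not add up, as `F` is not jointly concave.
So each value of the coefficient is treated from the point reached after the previous backward
steps, and the drops telescope. The offsets `v` do not depend on `s`, hence disappear as `s → 0`. -/
theorem exists_sum_setIntegral_sub_le (hp : 1 ≤ p) (hF : Continuous F) (hC0 : 0 ≤ C)
    (hC : ∀ s, |F s| ≤ C * ‖s‖ ^ p)
    (hconc : ∀ ε ∈ A, ∀ s, ConcaveOn ℝ Set.univ fun z : X => F (s + (z, ε • z)))
    {Z : Ω → X} (hZ : MemLp Z (ENNReal.ofReal p) μ) {S : 𝕜 → Set Ω}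
    (hS : ∀ c, MeasurableSet (S c)) (w : X × X) (R : Finset 𝕜) (hR : ∀ c ∈ R, c ∈ A) :
    ∃ v : 𝕜 → X × X, ∀ s : ℝ, 0 < s →
      s * ∑ c ∈ R, ∫ ω in S c, (F (w - s • v c + (Z ω, c • Z ω)) - F (w - s • v c)) ∂μ ≤
        F w - F (w - s • ∑ c ∈ R, (∫ ω in S c, Z ω ∂μ, c • ∫ ω in S c, Z ω ∂μ)) := by
  classical
  induction R using Finset.induction_on with
  | empty => exact ⟨fun _ => 0, fun s _ => by simp⟩
  | insert a R ha ih =>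
    obtain ⟨v, hv⟩ := ih fun c hc => hR c (Finset.mem_insert_of_mem hc)
    set e := ∑ c ∈ R, (∫ ω in S c, Z ω ∂μ, c • ∫ ω in S c, Z ω ∂μ)
    refine ⟨Function.update v a e, fun s hs => ?_⟩
    have h1 := hv s hs
    have h2 := setIntegral_sub_le_of_concaveOn hp hF hC0 hC
      (hconc a (hR a (Finset.mem_insert_self a R))) hZ (hS a) (w - s • e) hs
    rw [Finset.sum_insert ha, Finset.sum_insert ha, mul_add, Function.update_self]
    have e1 : ∑ c ∈ R, ∫ ω in S c, (F (w - s • Function.update v a e c + (Z ω, c • Z ω)) -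
        F (w - s • Function.update v a e c)) ∂μ =
        ∑ c ∈ R, ∫ ω in S c, (F (w - s • v c + (Z ω, c • Z ω)) - F (w - s • v c)) ∂μ := by
      refine Finset.sum_congr rfl fun c hc => ?_
      rw [Function.update_of_ne (by rintro rfl; exact ha hc)]
    rw [e1, smul_add, add_comm (s • _), ← sub_sub]
    linarith

/-- The total displacement is `(0, ∫ a • Z)`, which is rewritten as the sum of just two zigzag
vectors. Concavity bounds the drops over `s`-multiples of these by `s` times the full drops; divide
by `s` and let `s → 0`. -/
theorem integral_sub_le_of_simpleFunc (hp : 1 ≤ p) (hF : Continuous F) (hC0 : 0 ≤ C)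
    (hC : ∀ s, |F s| ≤ C * ‖s‖ ^ p)
    (hconc : ∀ ε ∈ A, ∀ s, ConcaveOn ℝ Set.univ fun z : X => F (s + (z, ε • z)))
    {Z : Ω → X} (hZ : MemLp Z (ENNReal.ofReal p) μ) (hZ0 : ∫ ω, Z ω ∂μ = 0) (a : SimpleFunc Ω 𝕜)
    (ha : ∀ ω, a ω ∈ A) (w : X × X) {α γ : 𝕜} (hα : α ∈ A) (hγ : γ ∈ A) {z₁ z₂ : X}
    (hz : z₁ + z₂ = 0) (hz' : α • z₁ + γ • z₂ = ∫ ω, a ω • Z ω ∂μ) :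
    ∫ ω, (F (w + (Z ω, a ω • Z ω)) - F w) ∂μ ≤
      (F w - F (w - (z₁, α • z₁))) + (F w - F (w - (z₂, γ • z₂))) := by
  have hp0 : 0 < p := by linarith
  have hZi : Integrable Z μ := hZ.integrable (by simpa using hp)
  have hS : ∀ c, MeasurableSet (a ⁻¹' {c}) := fun c => a.measurableSet_fiber c
  obtain ⟨v, hv⟩ := exists_sum_setIntegral_sub_le hp hF hC0 hC hconc hZ hS w a.range (by
    intro c hc
    obtain ⟨ω, rfl⟩ := SimpleFunc.mem_range.1 hc
    exact ha ω)
  have hsum : ∑ c ∈ a.range, (∫ ω in a ⁻¹' {c}, Z ω ∂μ, c • ∫ ω in a ⁻¹' {c}, Z ω ∂μ) =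
      (z₁, α • z₁) + (z₂, γ • z₂) := by
    rw [Prod.mk_add_mk, hz, hz', integral_simpleFunc_apply a (G := fun c ω => c • Z ω) fun c _ => hZi.smul c,
      ← hZ0, integral_simpleFunc_apply a (G := fun _ ω => Z ω) fun c _ => hZi]
    simp_rw [integral_smul]
    exact Prod.ext (by simp [Prod.fst_sum]) (by simp [Prod.snd_sum])
  rw [hsum] at hv
  set s : ℕ → ℝ := fun n => 1 / ((n : ℝ) + 1)
  have hs0 : ∀ n, 0 < s n := fun n => by positivity
  have hs1 : ∀ n, s n ≤ 1 := fun n => by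
    simp only [s]; rw [div_le_one (by positivity)]; linarith [n.cast_nonneg (α := ℝ)]
  have hslim : Tendsto s atTop (𝓝 0) := tendsto_one_div_add_atTop_nhds_zero_nat
  have hlim : Tendsto (fun n => ∑ c ∈ a.range, ∫ ω in a ⁻¹' {c},
      (F (w - s n • v c + (Z ω, c • Z ω)) - F (w - s n • v c)) ∂μ) atTop
      (𝓝 (∫ ω, (F (w + (Z ω, a ω • Z ω)) - F w) ∂μ)) := by
    rw [integral_simpleFunc_apply a (G := fun c ω => F (w + (Z ω, c • Z ω)) - F w) fun c _ =>
      (integrable_comp_of_norm_le hp0 hF hC0 hC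
      ((aestronglyMeasurable_const).add (hZ.1.prodMk (hZ.1.const_smul c)))
      (memLp_const_add_mul_norm hZ ‖w‖ (1 + ‖c‖))
      (ae_of_all _ fun ω => norm_add_smul_le w c (Z ω))).sub (integrable_const _)]
    refine tendsto_finsetSum _ fun c _ => ?_
    have hw : Tendsto (fun n => w - s n • v c) atTop (𝓝 w) := by
      simpa using (tendsto_const_nhds (x := w)).sub (hslim.smul_const (v c))
    have hwn : ∀ n, ‖w - s n • v c‖ ≤ ‖w‖ + ‖v c‖ := by
      intro n
      refine (norm_sub_le _ _).trans ?_
      rw [norm_smul, Real.norm_of_nonneg (hs0 n).le]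
      have := mul_le_of_le_one_left (norm_nonneg (v c)) (hs1 n)
      linarith
    have hm : ∀ n, AEStronglyMeasurable (fun ω => w - s n • v c + (Z ω, c • Z ω)) μ := fun n =>
      (aestronglyMeasurable_const).add (hZ.1.prodMk (hZ.1.const_smul c))
    have hle : ∀ n ω, ‖w - s n • v c + (Z ω, c • Z ω)‖ ≤
        (‖w‖ + ‖v c‖) + (1 + ‖c‖) * ‖Z ω‖ := fun n ω =>
      (norm_add_smul_le _ c (Z ω)).trans (by linarith [hwn n])
    have hh := memLp_const_add_mul_norm hZ (‖w‖ + ‖v c‖) (1 + ‖c‖)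
    have hi' : ∀ w, Integrable (fun ω => F (w + (Z ω, c • Z ω))) μ := fun w =>
      integrable_comp_of_norm_le hp0 hF hC0 hC
      ((aestronglyMeasurable_const).add (hZ.1.prodMk (hZ.1.const_smul c)))
      (memLp_const_add_mul_norm hZ ‖w‖ (1 + ‖c‖))
      (ae_of_all _ fun ω => norm_add_smul_le w c (Z ω))
    have hi : ∀ n, Integrable (fun ω => F (w - s n • v c + (Z ω, c • Z ω))) μ := fun n =>
      integrable_comp_of_norm_le hp0 hF hC0 hC (hm n) hh (ae_of_all _ (hle n))
    have h1 := tendsto_integral_comp_of_norm_le (μ := μ.restrict (a ⁻¹' {c})) hp0 hF hC0 hC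
      (G := fun n ω => w - s n • v c + (Z ω, c • Z ω)) (G' := fun ω => w + (Z ω, c • Z ω))
      (fun n => (hm n).restrict) (hh.restrict _) (fun n => ae_of_all _ (hle n))
      (ae_of_all _ fun ω => hw.add_const _)
    have h2 : Tendsto (fun n => ∫ ω in a ⁻¹' {c}, F (w - s n • v c) ∂μ) atTop
        (𝓝 (∫ ω in a ⁻¹' {c}, F w ∂μ)) := by
      simp only [integral_const]
      exact ((hF.tendsto w).comp hw).const_smul _
    have h3 := h1.sub h2
    rw [← integral_sub (hi' w |>.integrableOn) (integrable_const _)] at h3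
    refine h3.congr fun n => ?_
    rw [← integral_sub (hi n).integrableOn (integrable_const _)]
  have hrhs : Tendsto (fun n => (F w - F (w - (z₁, α • z₁))) +
      (F (w - s n • (z₁, α • z₁)) - F (w - s n • (z₁, α • z₁) - (z₂, γ • z₂)))) atTop
      (𝓝 ((F w - F (w - (z₁, α • z₁))) + (F w - F (w - (z₂, γ • z₂))))) := by
    have hw : Tendsto (fun n => w - s n • (z₁, α • z₁)) atTop (𝓝 w) := by
      simpa using (tendsto_const_nhds (x := w)).sub (hslim.smul_const (z₁, α • z₁))
    exact (((hF.tendsto w).comp hw).sub ((hF.tendsto _).comp (hw.sub_const _))).const_add _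
  refine le_of_tendsto_of_tendsto' hlim hrhs fun n => ?_
  have h0 := hv (s n) (hs0 n)
  have h1 := sub_le_mul_sub_of_concaveOn (hconc α hα) w z₁ (hs0 n).le (hs1 n)
  have h2 := sub_le_mul_sub_of_concaveOn (hconc γ hγ) (w - s n • (z₁, α • z₁)) z₂ (hs0 n).le
    (hs1 n)
  rw [smul_add, ← sub_sub] at h0
  refine le_of_mul_le_mul_left ?_ (hs0 n)
  linarith

/-- The Jensen inequality for zigzag concave functions and increments `(Z, a Z)` with a random
coefficient `a` in `A`. -/
theorem integral_comp_add_le (hp : 1 ≤ p) (hF : Continuous F) (hC0 : 0 ≤ C)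
    (hC : ∀ s, |F s| ≤ C * ‖s‖ ^ p)
    (hconc : ∀ ε ∈ A, ∀ s, ConcaveOn ℝ Set.univ fun z : X => F (s + (z, ε • z)))
    (hA : A.Nontrivial) (hAb : Bornology.IsBounded A)
    {Z W : Ω → X} (hZ : MemLp Z (ENNReal.ofReal p) μ) (hZ0 : ∫ ω, Z ω ∂μ = 0)
    (hW0 : ∫ ω, W ω ∂μ = 0) {a : Ω → 𝕜} (ham : Measurable a) (ha : ∀ ω, a ω ∈ A)
    (hW : ∀ᵐ ω ∂μ, W ω = a ω • Z ω) (w : X × X) :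
    ∫ ω, F (w + (Z ω, W ω)) ∂μ ≤ F w := by
  have hp0 : 0 < p := by linarith
  have hZi : Integrable Z μ := hZ.integrable (by simpa using hp)
  obtain ⟨α, hα, γ, hγ, hne⟩ := hA
  have hne' : γ - α ≠ 0 := sub_ne_zero.2 hne.symm
  obtain ⟨M, hM⟩ := hAb.exists_norm_le
  set b : ℕ → SimpleFunc Ω 𝕜 := SimpleFunc.approxOn a ham A α hα
  have hbA : ∀ n ω, b n ω ∈ A := SimpleFunc.approxOn_mem ham hα
  have hblim : ∀ ω, Tendsto (fun n => b n ω) atTop (𝓝 (a ω)) := fun ω =>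
    SimpleFunc.tendsto_approxOn ham hα (subset_closure (ha ω))
  -- Approximating `a` by simple functions destroys the centring of `a • Z`; the defect `y n` tends
  -- to zero.
  set y : ℕ → X := fun n => ∫ ω, b n ω • Z ω ∂μ
  have hbm : ∀ n, AEStronglyMeasurable (fun ω => b n ω • Z ω) μ := fun n =>
    (b n).stronglyMeasurable.aestronglyMeasurable.smul hZ.1
  have hy : Tendsto y atTop (𝓝 0) := by
    rw [← hW0, integral_congr_ae hW]
    refine tendsto_integral_of_dominated_convergence (fun ω => M * ‖Z ω‖) hbm
      (hZi.norm.const_mul M) (fun n => ae_of_all _ fun ω => ?_)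
      (ae_of_all _ fun ω => (hblim ω).smul_const (Z ω))
    rw [norm_smul]
    exact mul_le_mul_of_nonneg_right (hM _ (hbA n ω)) (norm_nonneg _)
  have hmeas : ∀ n, AEStronglyMeasurable (fun ω => w + (Z ω, b n ω • Z ω)) μ := fun n =>
    aestronglyMeasurable_const.add (hZ.1.prodMk (hbm n))
  have hh := memLp_const_add_mul_norm hZ ‖w‖ (1 + M)
  have hle : ∀ n ω, ‖w + (Z ω, b n ω • Z ω)‖ ≤ ‖w‖ + (1 + M) * ‖Z ω‖ := fun n ω => by
    refine (norm_add_smul_le w (b n ω) (Z ω)).trans ?_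
    gcongr
    exact hM _ (hbA n ω)
  -- The vectors `-z n` and `z n`, with coefficients `α` and `γ`, represent the displacement `(0, y
  -- n)`.
  set z : ℕ → X := fun n => (γ - α)⁻¹ • y n
  have hz : Tendsto z atTop (𝓝 0) := by simpa using hy.const_smul (γ - α)⁻¹
  have step : ∀ n, ∫ ω, F (w + (Z ω, b n ω • Z ω)) ∂μ - F w ≤
      (F w - F (w - (-z n, α • (-z n)))) + (F w - F (w - (z n, γ • z n))) := by
    intro n
    have := integral_sub_le_of_simpleFunc hp hF hC0 hC hconc hZ hZ0 (b n) (hbA n) w hα hγ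
      (neg_add_cancel (z n)) (by
        rw [smul_neg, neg_add_eq_sub, ← sub_smul, smul_smul, mul_inv_cancel₀ hne', one_smul])
    rw [integral_sub _ (integrable_const _), integral_const, probReal_univ, one_smul] at this
    · exact this
    · exact integrable_comp_of_norm_le hp0 hF hC0 hC (hmeas n) hh (ae_of_all _ (hle n))
  have h1 : Tendsto (fun n => ∫ ω, F (w + (Z ω, b n ω • Z ω)) ∂μ - F w) atTop
      (𝓝 (∫ ω, F (w + (Z ω, W ω)) ∂μ - F w)) := by
    refine (tendsto_integral_comp_of_norm_le hp0 hF hC0 hC hmeas hh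
      (fun n => ae_of_all _ (hle n)) ?_).sub_const _
    filter_upwards [hW] with ω hω
    rw [hω]
    exact tendsto_const_nhds.add (tendsto_const_nhds.prodMk_nhds ((hblim ω).smul_const (Z ω)))
  have h2 : Tendsto (fun n => (F w - F (w - (-z n, α • (-z n)))) +
      (F w - F (w - (z n, γ • z n)))) atTop (𝓝 0) := by
    have c1 : Tendsto (fun n => F (w - (-z n, α • (-z n)))) atTop (𝓝 (F w)) := by
      have : Tendsto (fun n => w - (-z n, α • (-z n))) atTop (𝓝 (w - (-0, α • (-0)))) :=
        tendsto_const_nhds.sub (hz.neg.prodMk_nhds (hz.neg.const_smul α))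
      simpa [Function.comp_def, Prod.mk_zero_zero] using (hF.tendsto _).comp this
    have c2 : Tendsto (fun n => F (w - (z n, γ • z n))) atTop (𝓝 (F w)) := by
      have : Tendsto (fun n => w - (z n, γ • z n)) atTop (𝓝 (w - (0, γ • 0))) :=
        tendsto_const_nhds.sub (hz.prodMk_nhds (hz.const_smul γ))
      simpa [Function.comp_def, Prod.mk_zero_zero] using (hF.tendsto _).comp this
    simpa using (c1.const_sub (F w)).add (c2.const_sub (F w))
  have := le_of_tendsto_of_tendsto' h1 h2 step
  linarith

end OneStep

/-! ### From dyadic walks to subordinate martingales -/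

section Subordination

variable {𝕜 : Type u} [RCLike 𝕜] {X : Type v} [NormedAddCommGroup X] [NormedSpace 𝕜 X]
  [NormedSpace ℝ X] [IsScalarTower ℝ 𝕜 X] [CompleteSpace X]
  {p C : ℝ} {A : Set 𝕜} {F : X × X → ℝ} {Ω : Type w} {m : MeasurableSpace Ω} {μ : Measure Ω}
  [IsProbabilityMeasure μ]

/-- Cutting both increments off outside `S` keeps the coefficient `a` and the centring, so the
unconditional inequality localizes. -/
theorem setIntegral_comp_add_sub_le (hp : 1 ≤ p) (hF : Continuous F) (hC0 : 0 ≤ C)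
    (hC : ∀ s, |F s| ≤ C * ‖s‖ ^ p)
    (hconc : ∀ ε ∈ A, ∀ s, ConcaveOn ℝ Set.univ fun z : X => F (s + (z, ε • z)))
    (hA : A.Nontrivial) (hAb : Bornology.IsBounded A)
    {Z W : Ω → X} (hZ : MemLp Z (ENNReal.ofReal p) μ) (hWL : MemLp W (ENNReal.ofReal p) μ)
    {S : Set Ω} (hS : MeasurableSet S)
    (hZ0 : ∫ ω in S, Z ω ∂μ = 0) (hW0 : ∫ ω in S, W ω ∂μ = 0) {a : Ω → 𝕜} (ham : Measurable a)
    (ha : ∀ ω, a ω ∈ A) (hW : ∀ᵐ ω ∂μ, W ω = a ω • Z ω) (w : X × X) :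
    ∫ ω in S, (F (w + (Z ω, W ω)) - F w) ∂μ ≤ 0 := by
  have hp0 : 0 < p := by linarith
  have h := integral_comp_add_le (Z := S.indicator Z) (W := S.indicator W) hp hF hC0 hC hconc hA
    hAb (hZ.indicator hS) (by rwa [integral_indicator hS]) (by rwa [integral_indicator hS]) ham ha
    (by
      filter_upwards [hW] with ω hω
      by_cases h : ω ∈ S
      · simp [h, hω]
      · simp [h]) w
  have e : (fun ω => F (w + (S.indicator Z ω, S.indicator W ω))) =
      fun ω => S.indicator (fun ω => F (w + (Z ω, W ω)) - F w) ω + F w := by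
    ext ω
    by_cases h : ω ∈ S
    · simp [h]
    · simp [h, Prod.mk_zero_zero]
  have hi : Integrable (fun ω => F (w + (Z ω, W ω))) μ := by
    have hh : MemLp (fun ω => ‖w‖ + (‖Z ω‖ + ‖W ω‖)) (ENNReal.ofReal p) μ :=
      (memLp_const ‖w‖).add (hZ.norm.add hWL.norm)
    have hm : AEStronglyMeasurable (fun ω => w + (Z ω, W ω)) μ :=
      aestronglyMeasurable_const.add (hZ.1.prodMk hWL.1)
    refine integrable_comp_of_norm_le hp0 hF hC0 hC hm hh (ae_of_all _ fun ω => ?_)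
    refine (norm_add_le _ _).trans ?_
    gcongr
    exact max_le (le_add_of_nonneg_right (norm_nonneg _)) (le_add_of_nonneg_left (norm_nonneg _))
  have hi' : Integrable (fun ω => S.indicator (fun ω => F (w + (Z ω, W ω)) - F w) ω) μ :=
    Integrable.indicator (hi.sub (integrable_const (F w))) hS
  have h2 : ∫ ω, (S.indicator (fun ω => F (w + (Z ω, W ω)) - F w) ω + F w) ∂μ =
      ∫ ω in S, (F (w + (Z ω, W ω)) - F w) ∂μ + F w := by
    rw [integral_add hi' (integrable_const (F w)), integral_indicator hS, integral_const,
      probReal_univ, one_smul]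
  rw [e, h2] at h
  linarith

/-- A zigzag concave function of a pair of martingales decreases in the mean along a differentially
subordinate step. -/
theorem integral_comp_step_le (hp : 1 ≤ p) (hF : Continuous F) (hC0 : 0 ≤ C)
    (hC : ∀ s, |F s| ≤ C * ‖s‖ ^ p)
    (hconc : ∀ ε ∈ A, ∀ s, ConcaveOn ℝ Set.univ fun z : X => F (s + (z, ε • z)))
    (hA : A.Nontrivial) (hAb : Bornology.IsBounded A) {𝒢 m : MeasurableSpace Ω} (h𝒢 : 𝒢 ≤ m)
    {μ : Measure Ω} [IsProbabilityMeasure μ]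
    {f g Z W : Ω → X} (hf : StronglyMeasurable[𝒢] f) (hg : StronglyMeasurable[𝒢] g)
    (hfL : MemLp f (ENNReal.ofReal p) μ) (hgL : MemLp g (ENNReal.ofReal p) μ)
    (hZ : MemLp Z (ENNReal.ofReal p) μ) (hWL : MemLp W (ENNReal.ofReal p) μ)
    (hZ0 : ∀ S, MeasurableSet[𝒢] S → ∫ ω in S, Z ω ∂μ = 0)
    (hW0 : ∀ S, MeasurableSet[𝒢] S → ∫ ω in S, W ω ∂μ = 0)
    {a : Ω → 𝕜} (ham : Measurable a)
    (ha : ∀ ω, a ω ∈ A) (hW : ∀ᵐ ω ∂μ, W ω = a ω • Z ω) :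
    ∫ ω, F (f ω + Z ω, g ω + W ω) ∂μ ≤ ∫ ω, F (f ω, g ω) ∂μ := by
  have hp0 : 0 < p := by linarith
  have hF0 : F 0 = 0 := by
    have := hC 0
    rw [norm_zero, Real.zero_rpow hp0.ne', mul_zero] at this
    exact abs_nonpos_iff.1 this
  have hH : StronglyMeasurable[𝒢] fun ω => (f ω, g ω) := hf.prodMk hg
  set H : Ω → X × X := fun ω => (f ω, g ω)
  set V : Ω → X × X := fun ω => (Z ω, W ω)
  have hVm : AEStronglyMeasurable V μ := hZ.1.prodMk hWL.1
  set K : ℕ → Ω → X × X := fun j => hH.approx j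
  have hKm : ∀ j, StronglyMeasurable[𝒢] (K j) := fun j => (hH.approx j).stronglyMeasurable
  have hKlim : ∀ ω, Tendsto (fun j => K j ω) atTop (𝓝 (H ω)) := hH.tendsto_approx
  -- The simple approximations of the current state need not be dominated. They are on `S j`, which
  -- is `𝒢`-measurable, so the increments are still centred on its pieces.
  set S : ℕ → Set Ω := fun j => {ω | ‖K j ω - H ω‖ ≤ 1}
  have hS : ∀ j, MeasurableSet[𝒢] (S j) := fun j =>
    ((hKm j).sub hH).norm.measurableSet_le stronglyMeasurable_const
  have hbound : ∀ j, ∀ ω ∈ S j, ‖K j ω‖ ≤ 1 + (‖f ω‖ + ‖g ω‖) := by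
    intro j ω hω
    have h1 : ‖K j ω‖ ≤ ‖K j ω - H ω‖ + ‖H ω‖ := by
      simpa using norm_add_le (K j ω - H ω) (H ω)
    have h2 : ‖H ω‖ ≤ ‖f ω‖ + ‖g ω‖ :=
      max_le (le_add_of_nonneg_right (norm_nonneg _)) (le_add_of_nonneg_left (norm_nonneg _))
    have h3 : ‖K j ω - H ω‖ ≤ 1 := hω
    linarith
  have hVb : ∀ ω, ‖V ω‖ ≤ ‖Z ω‖ + ‖W ω‖ := fun ω =>
    max_le (le_add_of_nonneg_right (norm_nonneg _)) (le_add_of_nonneg_left (norm_nonneg _))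
  have hh : MemLp (fun ω => 1 + (‖f ω‖ + ‖g ω‖) + (‖Z ω‖ + ‖W ω‖)) (ENNReal.ofReal p) μ :=
    ((memLp_const (1 : ℝ)).add (hfL.norm.add hgL.norm)).add (hZ.norm.add hWL.norm)
  have hSev : ∀ ω, ∀ᶠ j in atTop, ω ∈ S j := by
    intro ω
    have : Tendsto (fun j => ‖K j ω - H ω‖) atTop (𝓝 0) := by
      simpa using ((hKlim ω).sub_const (H ω)).norm
    exact (this.eventually_le_const zero_lt_one)
  have hleV : ∀ j ω, ‖(S j).indicator (fun ω => K j ω + V ω) ω‖ ≤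
      1 + (‖f ω‖ + ‖g ω‖) + (‖Z ω‖ + ‖W ω‖) := by
    intro j ω
    by_cases h : ω ∈ S j
    · rw [Set.indicator_of_mem h]
      exact (norm_add_le _ _).trans (add_le_add (hbound j ω h) (hVb ω))
    · rw [Set.indicator_of_notMem h, norm_zero]
      positivity
  have hle : ∀ j ω, ‖(S j).indicator (K j) ω‖ ≤
      1 + (‖f ω‖ + ‖g ω‖) + (‖Z ω‖ + ‖W ω‖) := by
    intro j ω
    by_cases h : ω ∈ S j
    · rw [Set.indicator_of_mem h]
      exact (hbound j ω h).trans (le_add_of_nonneg_right (by positivity))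
    · rw [Set.indicator_of_notMem h, norm_zero]
      positivity
  have hm1 : ∀ j, AEStronglyMeasurable ((S j).indicator fun ω => K j ω + V ω) μ := fun j =>
    (((hKm j).mono h𝒢).aestronglyMeasurable.add hVm).indicator (h𝒢 _ (hS j))
  have hm2 : ∀ j, AEStronglyMeasurable ((S j).indicator (K j)) μ := fun j =>
    ((hKm j).mono h𝒢).aestronglyMeasurable.indicator (h𝒢 _ (hS j))
  have ineq : ∀ j, ∫ ω, F ((S j).indicator (fun ω => K j ω + V ω) ω) ∂μ ≤
      ∫ ω, F ((S j).indicator (K j) ω) ∂μ := by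
    intro j
    have hSm := h𝒢 _ (hS j)
    have hi1 : Integrable (fun ω => F ((S j).indicator (fun ω => K j ω + V ω) ω)) μ :=
      integrable_comp_of_norm_le hp0 hF hC0 hC
        (hm1 j) hh (ae_of_all _ (hleV j))
    have hi2 : Integrable (fun ω => F ((S j).indicator (K j) ω)) μ :=
      integrable_comp_of_norm_le hp0 hF hC0 hC
        (hm2 j) hh (ae_of_all _ (hle j))
    rw [← sub_nonpos, ← integral_sub hi1 hi2]
    set b : SimpleFunc Ω (X × X) := (hH.approx j).toLargerSpace h𝒢
    have hb : ∀ ω, b ω = K j ω := fun ω => rfl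
    have hic : ∀ c : X × X, Integrable (fun ω => F (c + V ω) - F c) μ := by
      intro c
      have hh' : MemLp (fun ω => ‖c‖ + (‖Z ω‖ + ‖W ω‖)) (ENNReal.ofReal p) μ :=
        (memLp_const ‖c‖).add (hZ.norm.add hWL.norm)
      have hm : AEStronglyMeasurable (fun ω => c + V ω) μ := aestronglyMeasurable_const.add hVm
      refine (integrable_comp_of_norm_le hp0 hF hC0 hC hm hh' (ae_of_all _ fun ω => ?_)).sub
        (integrable_const (F c))
      exact (norm_add_le _ _).trans (by gcongr; exact hVb ω)
    have e : ∀ ω, F ((S j).indicator (fun ω => K j ω + V ω) ω) - F ((S j).indicator (K j) ω) =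
        (S j).indicator (fun ω' => F (b ω + V ω') - F (b ω)) ω := by
      intro ω
      by_cases h : ω ∈ S j
      · simp [h, hb]
      · simp [h]
    simp_rw [e]
    rw [integral_simpleFunc_apply b
      (G := fun c => (S j).indicator (fun ω => F (c + V ω) - F c))
      (fun c _ => (hic c).indicator hSm)]
    refine Finset.sum_nonpos fun c _ => ?_
    rw [integral_indicator hSm, Measure.restrict_restrict hSm]
    have hT : MeasurableSet[𝒢] (S j ∩ b ⁻¹' {c}) :=
      @MeasurableSet.inter _ 𝒢 _ _ (hS j) (@SimpleFunc.measurableSet_fiber _ _ 𝒢 (hH.approx j) c)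
    exact setIntegral_comp_add_sub_le hp hF hC0 hC hconc hA hAb hZ hWL (h𝒢 _ hT) (hZ0 _ hT)
      (hW0 _ hT) ham ha hW c
  have lim1 := tendsto_integral_comp_of_norm_le (G' := fun ω => H ω + V ω) hp0 hF hC0 hC hm1 hh
    (fun j => ae_of_all _ (hleV j)) (ae_of_all _ fun ω => by
      refine ((hKlim ω).add_const (V ω)).congr' ?_
      filter_upwards [hSev ω] with j hj
      rw [Set.indicator_of_mem hj])
  have lim2 := tendsto_integral_comp_of_norm_le (G' := H) hp0 hF hC0 hC hm2 hh
    (fun j => ae_of_all _ (hle j)) (ae_of_all _ fun ω => by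
      refine (hKlim ω).congr' ?_
      filter_upwards [hSev ω] with j hj
      rw [Set.indicator_of_mem hj])
  exact le_of_tendsto_of_tendsto' lim1 lim2 ineq

/-- The sharp subordination inequality from the inequality for dyadic walks. -/
theorem WalshUMD.lintegral_le {B : ℝ} (hU : WalshUMD 𝕜 X p A B) (hp : 1 ≤ p) (hB : 0 ≤ B)
    (hA : A.Nontrivial) (hAb : Bornology.IsBounded A) (ℱ : Filtration ℕ m) {f g : ℕ → Ω → X}
    {a : ℕ → Ω → 𝕜} {N : ℕ}
    (hf : ∀ n ≤ N, StronglyMeasurable[ℱ n] (f n)) (hg : ∀ n ≤ N, StronglyMeasurable[ℱ n] (g n))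
    (hfL : ∀ n ≤ N, MemLp (f n) (ENNReal.ofReal p) μ)
    (hgL : ∀ n ≤ N, MemLp (g n) (ENNReal.ofReal p) μ)
    (hf0 : ∀ n < N, ∀ S, MeasurableSet[ℱ n] S → ∫ ω in S, (f (n + 1) ω - f n ω) ∂μ = 0)
    (hg0 : ∀ n < N, ∀ S, MeasurableSet[ℱ n] S → ∫ ω in S, (g (n + 1) ω - g n ω) ∂μ = 0)
    (ham : ∀ n, Measurable (a n)) (ha : ∀ n ω, a n ω ∈ A)
    (h0 : ∀ᵐ ω ∂μ, g 0 ω = a 0 ω • f 0 ω)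
    (hsucc : ∀ n < N, ∀ᵐ ω ∂μ, g (n + 1) ω - g n ω = a (n + 1) ω • (f (n + 1) ω - f n ω)) :
    ∫⁻ ω, ‖g N ω‖ₑ ^ p ∂μ ≤ ENNReal.ofReal B * ∫⁻ ω, ‖f N ω‖ₑ ^ p ∂μ := by
  have hp0 : 0 < p := by linarith
  obtain ⟨C, hC0, hC⟩ := exists_abs_burkholderFun_le hU hA hp0 hB
  set F : X × X → ℝ := burkholderFun p A B
  have hF : Continuous F := continuous_burkholderFun hU hA hp0 hB
  have hconc : ∀ ε ∈ A, ∀ s, ConcaveOn ℝ Set.univ fun z : X => F (s + (z, ε • z)) :=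
    fun ε hε s => concaveOn_burkholderFun hU hA hp0 hB hε s
  have mono : ∀ n ≤ N, ∫ ω, F (f n ω, g n ω) ∂μ ≤ 0 := by
    intro n
    induction n with
    | zero =>
      intro _
      refine integral_nonpos_of_ae ?_
      filter_upwards [h0] with ω hω
      rw [hω]
      exact burkholderFun_diag_nonpos hU _ (ha 0 ω)
    | succ n ih =>
      intro hn
      refine le_trans ?_ (ih (by omega))
      have := integral_comp_step_le (μ := μ) hp hF hC0 hC hconc hA hAb (ℱ.le n)
        (hf n (by omega)) (hg n (by omega)) (hfL n (by omega)) (hgL n (by omega))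
        ((hfL (n + 1) hn).sub (hfL n (by omega))) ((hgL (n + 1) hn).sub (hgL n (by omega)))
        (hf0 n (by omega)) (hg0 n (by omega)) (ham (n + 1)) (ha (n + 1)) (hsucc n (by omega))
      simpa using this
  have nrm : ∀ {h : Ω → X}, MemLp h (ENNReal.ofReal p) μ →
      Integrable (fun ω => ‖h ω‖ ^ p) μ ∧
        ∫⁻ ω, ‖h ω‖ₑ ^ p ∂μ = ENNReal.ofReal (∫ ω, ‖h ω‖ ^ p ∂μ) := by
    intro h hh
    have hi : Integrable (fun ω => ‖h ω‖ ^ p) μ := by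
      have := hh.integrable_norm_rpow (by simpa using hp0) ENNReal.ofReal_ne_top
      rwa [ENNReal.toReal_ofReal hp0.le] at this
    refine ⟨hi, ?_⟩
    rw [ofReal_integral_eq_lintegral_ofReal hi (ae_of_all _ fun ω => by positivity)]
    refine lintegral_congr fun ω => ?_
    rw [← ENNReal.ofReal_rpow_of_nonneg (norm_nonneg _) hp0.le, ofReal_norm]
  obtain ⟨i1, e1⟩ := nrm (hfL N le_rfl)
  obtain ⟨i2, e2⟩ := nrm (hgL N le_rfl)
  rw [e1, e2, ← ENNReal.ofReal_mul hB]
  refine ENNReal.ofReal_le_ofReal ?_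
  have hFi : Integrable (fun ω => F (f N ω, g N ω)) μ :=
    integrable_comp_of_norm_le hp0 hF hC0 hC (h := fun ω => ‖f N ω‖ + ‖g N ω‖)
      ((hfL N le_rfl).1.prodMk (hgL N le_rfl).1) ((hfL N le_rfl).norm.add (hgL N le_rfl).norm)
      (ae_of_all _ fun ω => max_le (le_add_of_nonneg_right (norm_nonneg _))
        (le_add_of_nonneg_left (norm_nonneg _)))
  have h1 : ∫ ω, (‖g N ω‖ ^ p - B * ‖f N ω‖ ^ p) ∂μ ≤ ∫ ω, F (f N ω, g N ω) ∂μ :=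
    integral_mono (i2.sub (i1.const_mul B)) hFi fun ω => powGain_le_burkholderFun hU hA (f N ω, g N ω)
  rw [integral_sub i2 (i1.const_mul B), integral_const_mul] at h1
  linarith [mono N le_rfl]

end Subordination

/-! ### Walks as transforms with deterministic coefficients -/

section SumMeasure

variable {α β : Type*} [mα : MeasurableSpace α] [mβ : MeasurableSpace β]

/-- The even mixture of two measures on a disjoint union. -/
noncomputable def coinMeasure (μ : Measure α) (ν : Measure β) : Measure (α ⊕ β) :=
  (2⁻¹ : ℝ≥0∞) • μ.map Sum.inl + (2⁻¹ : ℝ≥0∞) • ν.map Sum.inr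

instance isProbabilityMeasure_coinMeasure (μ : Measure α) (ν : Measure β) [IsProbabilityMeasure μ]
    [IsProbabilityMeasure ν] : IsProbabilityMeasure (coinMeasure μ ν) := by
  constructor
  rw [coinMeasure, Measure.add_apply, Measure.smul_apply, Measure.smul_apply,
    Measure.map_apply measurable_inl MeasurableSet.univ,
    Measure.map_apply measurable_inr MeasurableSet.univ]
  simp [ENNReal.inv_two_add_inv_two]

instance discreteMeasurableSpace_sum [DiscreteMeasurableSpace α] [DiscreteMeasurableSpace β] :
    DiscreteMeasurableSpace (α ⊕ β) :=
  ⟨fun _ => measurableSet_sum_iff.2 ⟨.of_discrete, .of_discrete⟩⟩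

theorem setIntegral_coinMeasure [Finite α] [Finite β] [DiscreteMeasurableSpace α]
    [DiscreteMeasurableSpace β] {E : Type*} [NormedAddCommGroup E] [NormedSpace ℝ E]
    (μ : Measure α) (ν : Measure β) [IsProbabilityMeasure μ] [IsProbabilityMeasure ν]
    (f : α ⊕ β → E) (s : Set (α ⊕ β)) :
    ∫ ω in s, f ω ∂coinMeasure μ ν =
      (2⁻¹ : ℝ) • (∫ ω in Sum.inl ⁻¹' s, f (.inl ω) ∂μ + ∫ ω in Sum.inr ⁻¹' s, f (.inr ω) ∂ν) := by
  have hs : MeasurableSet s := .of_discrete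
  have : IsProbabilityMeasure (μ.map (Sum.inl : α → α ⊕ β)) :=
    Measure.isProbabilityMeasure_map measurable_inl.aemeasurable
  have : IsProbabilityMeasure (ν.map (Sum.inr : β → α ⊕ β)) :=
    Measure.isProbabilityMeasure_map measurable_inr.aemeasurable
  rw [coinMeasure, Measure.restrict_add, Measure.restrict_smul, Measure.restrict_smul,
    Measure.restrict_map measurable_inl hs, Measure.restrict_map measurable_inr hs,
    integral_add_measure, integral_smul_measure, integral_smul_measure,
    integral_map measurable_inl.aemeasurable StronglyMeasurable.of_discrete.aestronglyMeasurable,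
    integral_map measurable_inr.aemeasurable StronglyMeasurable.of_discrete.aestronglyMeasurable,
    smul_add]
  · simp
  · rw [← Measure.restrict_map measurable_inl hs]
    exact (Integrable.of_finite.restrict).smul_measure (by simp)
  · rw [← Measure.restrict_map measurable_inr hs]
    exact (Integrable.of_finite.restrict).smul_measure (by simp)

end SumMeasure

theorem stronglyMeasurable_sumElim {α β E : Type*} [Finite α] [Finite β] {mα : MeasurableSpace α}
    {mβ : MeasurableSpace β} [NormedAddCommGroup E] {f : α → E} {g : β → E}
    (hf : StronglyMeasurable f) (hg : StronglyMeasurable g) : StronglyMeasurable (Sum.elim f g) := by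
  borelize E
  rw [stronglyMeasurable_iff_measurable_separable]
  exact ⟨hf.measurable.sumElim hg.measurable, (Set.finite_range _).isSeparable⟩

/-- A dyadic walk with predictable coefficients is a martingale transform with deterministic
coefficients: the nodes of the tree are visited one after the other. -/
theorem WalshTree.exists_martingale {𝕜 : Type u} [RCLike 𝕜] {X : Type v} [NormedAddCommGroup X]
    [NormedSpace 𝕜 X] [NormedSpace ℝ X] [CompleteSpace X] {A : Set 𝕜} (T : WalshTree 𝕜 X)
    (hT : T.CoeffIn A) :
    ∃ (Ω : Type w) (_ : Finite Ω) (m : MeasurableSpace Ω) (_ : DiscreteMeasurableSpace Ω)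
      (μ : Measure Ω) (_ : IsProbabilityMeasure μ) (ℱ : Filtration ℕ m) (M : ℕ → Ω → X)
      (n : ℕ) (c : ℕ → 𝕜), (∀ i < n, c i ∈ A) ∧ M 0 = 0 ∧ (∀ i, n ≤ i → M i = M n) ∧
      Martingale M ℱ μ ∧ ∀ (Φ : X × X → ℝ) (s : X × X), T.mean Φ s =
        ∫ ω, Φ (s.1 + M n ω, s.2 + ∑ i ∈ Finset.range n, c i • (M (i + 1) ω - M i ω)) ∂μ := by
  induction T with
  | leaf =>
    refine ⟨PUnit.{w + 1}, inferInstance, inferInstance, inferInstance, Measure.dirac PUnit.unit,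
      inferInstance, ⊤, fun _ => 0, 0, fun _ => 0, by simp, rfl, fun _ _ => rfl,
      martingale_zero _ _ _, fun Φ s => ?_⟩
    simp [mean, run]
  | node ε z l r ihl ihr =>
    obtain ⟨Ω₁, _, m₁, _, μ₁, _, ℱ₁, M₁, n₁, c₁, hc₁, h0₁, hst₁, hM₁, hm₁⟩ := ihl hT.2.1
    obtain ⟨Ω₂, _, m₂, _, μ₂, _, ℱ₂, M₂, n₂, c₂, hc₂, h0₂, hst₂, hM₂, hm₂⟩ := ihr hT.2.2
    let 𝒢 : ℕ → MeasurableSpace (Ω₁ ⊕ Ω₂) := fun i =>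
      i.casesOn ⊥ fun i => @Sum.instMeasurableSpace _ _ (ℱ₁ i) (ℱ₂ (i - n₁))
    have h𝒢 : ∀ i s, MeasurableSet[𝒢 (i + 1)] s ↔
        MeasurableSet[ℱ₁ i] (Sum.inl ⁻¹' s) ∧ MeasurableSet[ℱ₂ (i - n₁)] (Sum.inr ⁻¹' s) := by
      intro i s
      exact @measurableSet_sum_iff _ _ (ℱ₁ i) (ℱ₂ (i - n₁)) s
    let ℱ : Filtration ℕ (Sum.instMeasurableSpace : MeasurableSpace (Ω₁ ⊕ Ω₂)) :=
      { seq := 𝒢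
        mono' := by
          refine monotone_nat_of_le_succ fun i => ?_
          cases i with
          | zero => exact bot_le
          | succ i =>
            intro s hs
            rw [h𝒢] at hs ⊢
            exact ⟨ℱ₁.mono (Nat.le_succ i) _ hs.1, ℱ₂.mono (by omega) _ hs.2⟩
        le' := fun i s _ => MeasurableSet.of_discrete }
    let M : ℕ → Ω₁ ⊕ Ω₂ → X := fun i =>
      i.casesOn 0 fun i => Sum.elim (fun ω => z + M₁ i ω) (fun ω => -z + M₂ (i - n₁) ω)
    -- After the root step at most one of the two branches moves at any time, so the coefficient can
    -- depend on time alone.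
    let c : ℕ → 𝕜 := fun i => i.casesOn ε fun i => if i < n₁ then c₁ i else c₂ (i - n₁)
    refine ⟨Ω₁ ⊕ Ω₂, inferInstance, inferInstance, inferInstance, coinMeasure μ₁ μ₂, inferInstance,
      ℱ, M, n₁ + n₂ + 1, c, ?_, rfl, ?_, ?_, ?_⟩
    · rintro (_ | i) hi
      · exact hT.1
      · simp only [c]
        split_ifs with h
        · exact hc₁ i h
        · exact hc₂ _ (by omega)
    · rintro (_ | i) hi
      · omega
      · simp only [M]
        rw [hst₁ i (by omega), hst₁ (n₁ + n₂) (by omega), hst₂ (i - n₁) (by omega),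
          hst₂ (n₁ + n₂ - n₁) (by omega)]
    · refine martingale_of_setIntegral_eq_succ ?_ (fun i => Integrable.of_finite) ?_
      · rintro (_ | i)
        · exact stronglyMeasurable_zero
        · exact @stronglyMeasurable_sumElim _ _ _ _ _ (ℱ₁ i) (ℱ₂ (i - n₁)) _ _ _
            (stronglyMeasurable_const.add (hM₁.1 i))
            (stronglyMeasurable_const.add (hM₂.1 (i - n₁)))
      · rintro (_ | i) s hs
        · rcases MeasurableSpace.measurableSet_bot_iff.1 hs with rfl | rfl
          · simp
          · rw [setIntegral_coinMeasure, setIntegral_coinMeasure]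
            simp [M, h0₁, h0₂]
        · have hs' := (h𝒢 i s).1 hs
          rw [setIntegral_coinMeasure, setIntegral_coinMeasure]
          simp only [M, Sum.elim_inl, Sum.elim_inr]
          have e : ∀ {Ω : Type w} [Finite Ω] [MeasurableSpace Ω] [DiscreteMeasurableSpace Ω]
              (μ : Measure Ω) [IsProbabilityMeasure μ] (f : Ω → X) (z : X) (s : Set Ω),
              ∫ ω in s, (z + f ω) ∂μ = ∫ ω in s, z ∂μ + ∫ ω in s, f ω ∂μ :=
            fun μ _ f z s => integral_add Integrable.of_finite Integrable.of_finite
          rw [e, e, e, e, hM₁.setIntegral_eq (Nat.le_succ i) hs'.1,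
            hM₂.setIntegral_eq (show i - n₁ ≤ i + 1 - n₁ by omega) hs'.2]
    · intro Φ s
      rw [← setIntegral_univ, setIntegral_coinMeasure]
      simp only [mean, run, walkStep] at hm₁ hm₂ ⊢
      rw [hm₁, hm₂, Set.preimage_univ, Set.preimage_univ, setIntegral_univ, setIntegral_univ,
        smul_eq_mul, div_eq_inv_mul]
      congr 2
      · refine integral_congr_ae (ae_of_all _ fun ω => ?_)
        simp only
        congr 2
        · simp only [M, Sum.elim_inl]
          rw [hst₁ (n₁ + n₂) (by omega), add_assoc]
        · rw [Finset.sum_range_succ', Finset.sum_range_add]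
          have z2 : ∑ i ∈ Finset.range n₂, c (n₁ + i + 1) • (M (n₁ + i + 1 + 1) (Sum.inl ω) -
              M (n₁ + i + 1) (Sum.inl ω)) = 0 := by
            refine Finset.sum_eq_zero fun i _ => ?_
            simp only [M, Sum.elim_inl]
            rw [hst₁ (n₁ + i + 1) (by omega), hst₁ (n₁ + i) (by omega), sub_self, smul_zero]
          have z1 : ∑ i ∈ Finset.range n₁, c (i + 1) • (M (i + 1 + 1) (Sum.inl ω) -
              M (i + 1) (Sum.inl ω)) =
              ∑ i ∈ Finset.range n₁, c₁ i • (M₁ (i + 1) ω - M₁ i ω) := by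
            refine Finset.sum_congr rfl fun i hi => ?_
            simp only [M, c, Sum.elim_inl, if_pos (Finset.mem_range.1 hi), add_sub_add_left_eq_sub]
          have z0 : c 0 • (M (0 + 1) (Sum.inl ω) - M 0 (Sum.inl ω)) = ε • z := by
            change ε • (z + M₁ 0 ω - 0) = _
            rw [h0₁, Pi.zero_apply, add_zero, sub_zero]
          rw [z0, z1, z2]
          abel
      · refine integral_congr_ae (ae_of_all _ fun ω => ?_)
        simp only
        congr 2
        · simp only [M, Sum.elim_inr]
          rw [Nat.add_sub_cancel_left, ← add_assoc, ← sub_eq_add_neg]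
        · rw [Finset.sum_range_succ', Finset.sum_range_add]
          have z1 : ∑ i ∈ Finset.range n₁, c (i + 1) • (M (i + 1 + 1) (Sum.inr ω) -
              M (i + 1) (Sum.inr ω)) = 0 := by
            refine Finset.sum_eq_zero fun i hi => ?_
            have hi := Finset.mem_range.1 hi
            simp only [M, Sum.elim_inr]
            rw [show i + 1 - n₁ = 0 by omega, show i - n₁ = 0 by omega, sub_self, smul_zero]
          have z2 : ∑ i ∈ Finset.range n₂, c (n₁ + i + 1) • (M (n₁ + i + 1 + 1) (Sum.inr ω) -
              M (n₁ + i + 1) (Sum.inr ω)) =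
              ∑ i ∈ Finset.range n₂, c₂ i • (M₂ (i + 1) ω - M₂ i ω) := by
            refine Finset.sum_congr rfl fun i _ => ?_
            simp only [M, c, Sum.elim_inr, if_neg (show ¬ n₁ + i < n₁ by omega),
              add_sub_add_left_eq_sub, Nat.add_sub_cancel_left,
              show n₁ + i + 1 - n₁ = i + 1 by omega]
          have z0 : c 0 • (M (0 + 1) (Sum.inr ω) - M 0 (Sum.inr ω)) = -(ε • z) := by
            change ε • (-z + M₂ (0 - n₁) ω - 0) = _
            rw [Nat.zero_sub, h0₂, Pi.zero_apply, add_zero, sub_zero, smul_neg]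
          rw [z0, z1, z2]
          abel

theorem eLpNorm_le_mul_iff_lintegral {Ω : Type*} {m : MeasurableSpace Ω} {μ : Measure Ω}
    {E : Type*} [NormedAddCommGroup E] {p : ℝ} (hp : 0 < p) (f g : Ω → E) (β : ℝ≥0∞) :
    eLpNorm f (ENNReal.ofReal p) μ ≤ β * eLpNorm g (ENNReal.ofReal p) μ ↔
      ∫⁻ ω, ‖f ω‖ₑ ^ p ∂μ ≤ β ^ p * ∫⁻ ω, ‖g ω‖ₑ ^ p ∂μ := by
  rw [eLpNorm_eq_lintegral_rpow_enorm_toReal (by simpa using hp) ENNReal.ofReal_ne_top,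
    eLpNorm_eq_lintegral_rpow_enorm_toReal (by simpa using hp) ENNReal.ofReal_ne_top,
    ENNReal.toReal_ofReal hp.le, ← ENNReal.rpow_le_rpow_iff hp, ENNReal.mul_rpow_of_nonneg _ _ hp.le,
    ← ENNReal.rpow_mul, ← ENNReal.rpow_mul, one_div_mul_cancel hp.ne', ENNReal.rpow_one,
    ENNReal.rpow_one]

/-- The starting point `x` becomes a constant zeroth difference with coefficient `ε`; the
differences after it are those of the martingale of the tree. -/
theorem UMDInequality.walshUMD {𝕜 : Type u} [RCLike 𝕜] {X : Type v} [NormedAddCommGroup X]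
    [NormedSpace 𝕜 X] [NormedSpace ℝ X] [CompleteSpace X] {p : ℝ} (hp : 0 < p) {A : Set 𝕜}
    {β : ℝ≥0} (h : UMDInequality.{u, v, w} 𝕜 X p A β) : WalshUMD 𝕜 X p A ((β : ℝ) ^ p) := by
  intro T hT x ε hε
  obtain ⟨Ω, _, m, _, μ, _, ℱ, M, n, c, hc, h0, -, hM, hm⟩ :=
    WalshTree.exists_martingale.{u, v, w} T hT
  let d : ℕ → Ω → X := fun i => i.casesOn (fun _ => x) fun i ω => M (i + 1) ω - M i ω
  let e : ℕ → 𝕜 := fun i => i.casesOn ε c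
  have hd : ∀ k ω, ∑ i ∈ Finset.range (k + 1), d i ω = x + M k ω := by
    intro k ω
    rw [Finset.sum_range_succ', Finset.sum_range_sub (fun i => M i ω), h0]
    rw [Pi.zero_apply, sub_zero]
    exact add_comm _ _
  have key := h Ω m μ inferInstance ℱ d ⟨fun _ => MemLp.of_discrete, by
      simp_rw [hd]
      exact (martingale_const ℱ μ x).add hM⟩ (n + 1) e (by
      rintro (_ | i) hi
      · exact hε
      · exact hc i (by omega))
  simp_rw [hd] at key
  rw [eLpNorm_le_mul_iff_lintegral hp] at key
  have nrm : ∀ f : Ω → X, ∫⁻ ω, ‖f ω‖ₑ ^ p ∂μ = ENNReal.ofReal (∫ ω, ‖f ω‖ ^ p ∂μ) := by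
    intro f
    rw [ofReal_integral_eq_lintegral_ofReal Integrable.of_finite
      (ae_of_all _ fun ω => by positivity)]
    refine lintegral_congr fun ω => ?_
    rw [← ENNReal.ofReal_rpow_of_nonneg (norm_nonneg _) hp.le, ofReal_norm]
  rw [nrm, nrm, ← ENNReal.ofReal_coe_nnreal, ENNReal.ofReal_rpow_of_nonneg β.coe_nonneg hp.le,
    ← ENNReal.ofReal_mul (by positivity), ENNReal.ofReal_le_ofReal_iff (by positivity)] at key
  rw [hm]
  simp only [powGain]
  rw [integral_sub Integrable.of_finite Integrable.of_finite, integral_const_mul]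
  have e1 : ∀ ω, ∑ k ∈ Finset.range (n + 1), e k • d k ω =
      ε • x + ∑ i ∈ Finset.range n, c i • (M (i + 1) ω - M i ω) := by
    intro ω
    rw [Finset.sum_range_succ']
    exact add_comm _ _
  simp_rw [e1] at key
  linarith

/-! ### Random coefficients from weak subordination -/

section WeakSubordination

variable {𝕜 : Type u} [RCLike 𝕜] {X : Type v} [NormedAddCommGroup X] [NormedSpace 𝕜 X]
  {A : Set 𝕜} {Ω : Type w} {m : MeasurableSpace Ω} {μ : Measure Ω}

theorem QuotientMem.norm_le {M : ℝ} (hM : ∀ ε ∈ A, ‖ε‖ ≤ M) {c d : 𝕜} (h : QuotientMem A c d) :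
    ‖c‖ ≤ M * ‖d‖ := by
  rcases eq_or_ne d 0 with hd | hd
  · rw [h.1 hd, hd]; simp
  · have := hM _ (h.2 hd)
    rwa [norm_div, div_le_iff₀ (norm_pos_iff.2 hd)] at this

/-- Take norming functionals of a dense sequence near the separable range: one that norms a point
within `‖F ω‖ / 2` of `F ω` cannot vanish at `F ω`. -/
theorem exists_seq_dual_separating_range {F : Ω → X} (hF : StronglyMeasurable F) :
    ∃ φ : ℕ → StrongDual 𝕜 X, ∀ ω, F ω ≠ 0 → ∃ k, φ k (F ω) ≠ 0 := by
  obtain ⟨c, hc, hcl⟩ := hF.isSeparable_range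
  obtain ⟨y, hy⟩ := (hc.insert 0).exists_eq_range (Set.insert_nonempty 0 c)
  choose φ hφ1 hφ using fun k => exists_dual_vector'' 𝕜 (y k)
  refine ⟨φ, fun ω hω => ?_⟩
  have hpos : 0 < ‖F ω‖ := norm_pos_iff.2 hω
  obtain ⟨z, hz, hdist⟩ := Metric.mem_closure_iff.1 (hcl (Set.mem_range_self ω)) (‖F ω‖ / 2)
    (by positivity)
  obtain ⟨k, rfl⟩ : z ∈ Set.range y := hy ▸ Set.mem_insert_of_mem 0 hz
  refine ⟨k, fun h0 => ?_⟩
  rw [dist_eq_norm] at hdist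
  have h1 : ‖φ k (y k - F ω)‖ ≤ ‖F ω - y k‖ := by
    rw [norm_sub_rev (F ω)]
    exact (φ k).le_of_opNorm_le (hφ1 k) _ |>.trans_eq (one_mul _)
  rw [map_sub, h0, sub_zero, hφ, RCLike.norm_ofReal, abs_norm] at h1
  have := norm_sub_norm_le (F ω) (y k)
  linarith

/-- If all functionals of `G` are multiples of the functionals of `F` with random factors in `A`,
then `G` is a multiple of `F` with a random factor in `A`. -/
theorem exists_measurable_coeff (hAb : Bornology.IsBounded A) (hAc : IsClosed A)
    (hA : A.Nonempty) {F G : Ω → X} (hF : StronglyMeasurable F) (hG : StronglyMeasurable G)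
    (h : ∀ φ : StrongDual 𝕜 X, ∀ᵐ ω ∂μ, QuotientMem A (φ (G ω)) (φ (F ω))) :
    ∃ a : Ω → 𝕜, Measurable a ∧ (∀ ω, a ω ∈ A) ∧ ∀ᵐ ω ∂μ, G ω = a ω • F ω := by
  classical
  obtain ⟨α, hα⟩ := hA
  obtain ⟨M, hM⟩ := hAb.exists_norm_le
  obtain ⟨φ, hφ⟩ := exists_seq_dual_separating_range (𝕜 := 𝕜) hF
  have hex : ∀ ω, ∃ k, F ω = 0 ∨ φ k (F ω) ≠ 0 := fun ω => by
    by_cases h0 : F ω = 0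
    · exact ⟨0, Or.inl h0⟩
    · exact (hφ ω h0).imp fun _ => Or.inr
  have hmF : ∀ ψ : StrongDual 𝕜 X, Measurable fun ω => ψ (F ω) := fun ψ =>
    (ψ.continuous.comp_stronglyMeasurable hF).measurable
  have hmG : ∀ ψ : StrongDual 𝕜 X, Measurable fun ω => ψ (G ω) := fun ψ =>
    (ψ.continuous.comp_stronglyMeasurable hG).measurable
  set q : ℕ → Ω → 𝕜 := fun k ω =>
    if φ k (G ω) / φ k (F ω) ∈ A then φ k (G ω) / φ k (F ω) else α
  have hq : ∀ k, Measurable (q k) := fun k =>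
    Measurable.ite (((hmG _).div (hmF _)) hAc.measurableSet) ((hmG _).div (hmF _))
      measurable_const
  have hqA : ∀ k ω, q k ω ∈ A := fun k ω => by
    simp only [q]
    split_ifs with h'
    · exact h'
    · exact hα
  -- The coefficient is read off from the first functional that does not vanish at `F ω`.
  set a : Ω → 𝕜 := fun ω => q (Nat.find (hex ω)) ω
  have hset : ∀ k, MeasurableSet {ω | F ω = 0 ∨ φ k (F ω) ≠ 0} := fun k =>
    (hF.measurableSet_eq_fun stronglyMeasurable_const).union
      ((hmF (φ k)) (measurableSet_singleton 0)).compl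
  have ham : Measurable a := Measurable.find hq hset hex
  refine ⟨a, ham, fun ω => hqA _ ω, ?_⟩
  have hdiff : StronglyMeasurable fun ω => G ω - a ω • F ω :=
    hG.sub (ham.stronglyMeasurable.smul hF)
  have hzero : (fun ω => G ω - a ω • F ω) =ᵐ[μ] 0 := by
    refine ae_eq_zero_of_forall_dual_of_isSeparable 𝕜 hdiff.isSeparable_range (fun ψ => ?_)
      (ae_of_all _ fun ω => Set.mem_range_self ω)
    -- The null sets depend on the functional, so only countably many combinations of `φ k` and `ψ`
    -- are tested; the resulting norm bound extends to all scalars by density.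
    have hall : ∀ᵐ ω ∂μ, ∀ k : ℕ, ∀ j : ℕ,
        QuotientMem A ((φ k + TopologicalSpace.denseSeq 𝕜 j • ψ) (G ω))
          ((φ k + TopologicalSpace.denseSeq 𝕜 j • ψ) (F ω)) :=
      ae_all_iff.2 fun k => ae_all_iff.2 fun j => h _
    have hall' : ∀ᵐ ω ∂μ, ∀ k : ℕ, QuotientMem A (φ k (G ω)) (φ k (F ω)) :=
      ae_all_iff.2 fun k => h _
    filter_upwards [hall, hall', h ψ] with ω h1 h2 h3
    rw [Pi.zero_apply, map_sub, map_smul, smul_eq_mul, sub_eq_zero]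
    rcases eq_or_ne (ψ (F ω)) 0 with hψ | hψ
    · rw [hψ, mul_zero]; exact h3.1 hψ
    have hF0 : F ω ≠ 0 := fun h0 => hψ (by rw [h0, map_zero])
    set k := Nat.find (hex ω)
    have hk : φ k (F ω) ≠ 0 := (Nat.find_spec (hex ω)).resolve_left hF0
    have hak : a ω = φ k (G ω) / φ k (F ω) := if_pos ((h2 k).2 hk)
    have hr : ∀ r : 𝕜, ‖φ k (G ω) + r * ψ (G ω)‖ ≤ M * ‖φ k (F ω) + r * ψ (F ω)‖ := by
      intro r
      refine (TopologicalSpace.denseRange_denseSeq 𝕜).induction_on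
        (p := fun r => ‖φ k (G ω) + r * ψ (G ω)‖ ≤ M * ‖φ k (F ω) + r * ψ (F ω)‖) r ?_ ?_
      · exact isClosed_le (by fun_prop) (by fun_prop)
      · intro j
        simpa using (h1 k j).norm_le hM
    -- This scalar annihilates the combination at `F ω`, hence at `G ω`, so the quotients for `φ k`
    -- and `ψ` coincide.
    have h0 := hr (-(φ k (F ω) / ψ (F ω)))
    rw [neg_mul, neg_mul, div_mul_cancel₀ _ hψ, add_neg_cancel, norm_zero, mul_zero,
      norm_le_zero_iff, ← sub_eq_add_neg, sub_eq_zero] at h0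
    rw [hak, h0]
    field_simp
  filter_upwards [hzero] with ω hω
  exact sub_eq_zero.1 hω

end WeakSubordination

/-! ### Local martingales in discrete time -/

section LocalMartingale

variable {X : Type v} [NormedAddCommGroup X] [NormedSpace ℝ X] [CompleteSpace X] {Ω : Type w}
  {m : MeasurableSpace Ω} {μ : Measure Ω} {ℱ : Filtration ℕ m} {f : ℕ → Ω → X}
  {p : ℝ≥0∞}

/-- Take `S j = {k < τ j}`. It is known at time `k`, and since time is discrete the stopped process
agrees with `f` on it at both `k` and `k + 1`. -/
theorem IsLocalMartingale.exists_localizing_sets (hf : IsLocalMartingale f ℱ μ) (k : ℕ) :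
    ∃ S : ℕ → Set Ω, (∀ j, MeasurableSet[ℱ k] (S j)) ∧ (∀ᵐ ω ∂μ, ∀ᶠ j in atTop, ω ∈ S j) ∧
      ∀ j, Integrable ((S j).indicator (f (k + 1))) μ ∧
        μ[(S j).indicator (f (k + 1)) | ℱ k] =ᵐ[μ] (S j).indicator (f k) := by
  obtain ⟨-, τ, hτ, hY⟩ := hf
  refine ⟨fun j => {ω | WithTop.some k < τ j ω}, fun j => ?_, ?_, fun j => ?_⟩
  · have := (hτ.isStoppingTime j).measurableSet_gt k
    exact this
  · filter_upwards [hτ.tendsto_top] with ω hω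
    exact hω.eventually_const_lt (WithTop.coe_lt_top k)
  · set S : Set Ω := {ω | WithTop.some k < τ j ω}
    have hS : MeasurableSet[ℱ k] S := (hτ.isStoppingTime j).measurableSet_gt k
    set Y := stoppedProcess (fun i ↦ {ω | ⊥ < τ j ω}.indicator (f i)) (τ j)
    have hM : Martingale Y ℱ μ := hY j
    have hpos : ∀ ω ∈ S, ω ∈ {ω | ⊥ < τ j ω} := fun ω hω =>
      lt_of_le_of_lt (bot_le : (⊥ : WithTop ℕ) ≤ WithTop.some k) hω
    have e0 : S.indicator (Y k) = S.indicator (f k) := by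
      refine Set.indicator_congr fun ω hω => ?_
      simp only [Y]
      rw [stoppedProcess_eq_of_le (i := k) (le_of_lt hω), Set.indicator_of_mem (hpos ω hω)]
    have e1 : S.indicator (Y (k + 1)) = S.indicator (f (k + 1)) := by
      refine Set.indicator_congr fun ω hω => ?_
      simp only [Y]
      have hle : WithTop.some (k + 1) ≤ τ j ω := by
        have h : WithTop.some k < τ j ω := hω
        cases h' : τ j ω with
        | top => exact le_top
        | coe t =>
          rw [h'] at h
          exact WithTop.coe_le_coe.2 (WithTop.coe_lt_coe.1 h)
      rw [stoppedProcess_eq_of_le (i := k + 1) hle, Set.indicator_of_mem (hpos ω hω)]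
    rw [← e0, ← e1]
    refine ⟨(hM.integrable (k + 1)).indicator (ℱ.le k _ hS), ?_⟩
    refine (condExp_indicator (hM.integrable (k + 1)) hS).trans ?_
    filter_upwards [hM.2 k (k + 1) (Nat.le_succ k)] with ω hω
    by_cases h : ω ∈ S
    · rw [Set.indicator_of_mem h, Set.indicator_of_mem h, hω]
    · rw [Set.indicator_of_notMem h, Set.indicator_of_notMem h]

/-- Conditional expectation contracts `L^p`, so the cut-offs of `f k` are bounded by the norm of `f
(k + 1)`; Fatou removes the cut-off. -/
theorem IsLocalMartingale.memLp_of_succ (hf : IsLocalMartingale f ℱ μ) (hp : 1 ≤ p) {k : ℕ}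
    (h : MemLp (f (k + 1)) p μ) : MemLp (f k) p μ := by
  obtain ⟨S, hS, hev, hc⟩ := hf.exists_localizing_sets k
  have hm : StronglyMeasurable (f k) := (hf.1 k).mono (ℱ.le k)
  refine ⟨hm.aestronglyMeasurable, lt_of_le_of_lt ?_ h.2⟩
  refine (Lp.eLpNorm_lim_le_liminf_eLpNorm (f := fun j => (S j).indicator (f k))
    (fun j => hm.aestronglyMeasurable.indicator (ℱ.le k _ (hS j))) (f k) ?_).trans ?_
  · filter_upwards [hev] with ω hω
    refine tendsto_const_nhds.congr' ?_
    filter_upwards [hω] with j hj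
    rw [Set.indicator_of_mem hj]
  · have hle : ∀ j, eLpNorm ((S j).indicator (f k)) p μ ≤ eLpNorm (f (k + 1)) p μ := fun j => by
      rw [← eLpNorm_congr_ae (hc j).2]
      exact (eLpNorm_condExp_le_eLpNorm _ hp).trans (eLpNorm_indicator_le _)
    exact (liminf_le_liminf (Eventually.of_forall hle)).trans (by simp)

theorem IsLocalMartingale.memLp_of_le (hf : IsLocalMartingale f ℱ μ) (hp : 1 ≤ p) {n : ℕ}
    (h : MemLp (f n) p μ) {k : ℕ} (hk : k ≤ n) : MemLp (f k) p μ := by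
  induction n with
  | zero => rwa [Nat.le_zero.1 hk]
  | succ n ih =>
    rcases Nat.of_le_succ hk with hk | rfl
    · exact ih (hf.memLp_of_succ hp h) hk
    · exact h

variable [IsFiniteMeasure μ]

/-- The identity holds on each localizing set, and the increment itself dominates its cut-offs. -/
theorem IsLocalMartingale.setIntegral_sub_eq_zero (hf : IsLocalMartingale f ℱ μ) {k : ℕ}
    (h0 : Integrable (f k) μ) (h1 : Integrable (f (k + 1)) μ) {s : Set Ω}
    (hs : MeasurableSet[ℱ k] s) : ∫ ω in s, (f (k + 1) ω - f k ω) ∂μ = 0 := by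
  obtain ⟨S, hS, hev, hc⟩ := hf.exists_localizing_sets k
  have key : ∀ j, ∫ ω in s, (S j).indicator (fun ω => f (k + 1) ω - f k ω) ω ∂μ = 0 := by
    intro j
    have hS' := ℱ.le k _ (hS j)
    have e : (S j).indicator (fun ω => f (k + 1) ω - f k ω) =
        fun ω => (S j).indicator (f (k + 1)) ω - (S j).indicator (f k) ω :=
      Set.indicator_sub _ _ _
    rw [e, integral_sub (h1.indicator hS').integrableOn (h0.indicator hS').integrableOn,
      ← setIntegral_condExp (ℱ.le k) (hc j).1 hs, sub_eq_zero]
    exact integral_congr_ae (ae_restrict_of_ae (hc j).2)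
  have hlim : Tendsto (fun j => ∫ ω in s, (S j).indicator (fun ω => f (k + 1) ω - f k ω) ω ∂μ)
      atTop (𝓝 (∫ ω in s, (f (k + 1) ω - f k ω) ∂μ)) := by
    have hi : Integrable (fun ω => f (k + 1) ω - f k ω) μ := h1.sub h0
    refine tendsto_integral_of_dominated_convergence (fun ω => ‖f (k + 1) ω - f k ω‖)
      (fun j => (hi.1.indicator (ℱ.le k _ (hS j))).restrict) hi.norm.restrict
      (fun j => ae_of_all _ fun ω => norm_indicator_le_norm_self _ _) ?_
    filter_upwards [ae_restrict_of_ae hev] with ω hω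
    refine tendsto_const_nhds.congr' ?_
    filter_upwards [hω] with j hj
    rw [Set.indicator_of_mem hj]
  simp_rw [key] at hlim
  exact (tendsto_nhds_unique hlim tendsto_const_nhds)

end LocalMartingale

/-! ### Transfer between the inequalities and between sets of scalars -/

section Transfer

variable {𝕜 : Type u} [RCLike 𝕜] {X : Type v} [NormedAddCommGroup X] [NormedSpace 𝕜 X]
  [NormedSpace ℝ X] [CompleteSpace X] {p : ℝ} {A : Set 𝕜}

theorem UMDInequality.mono {β β' : ℝ≥0∞} (h : UMDInequality.{u, v, w} 𝕜 X p A β) (hβ : β ≤ β') :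
    UMDInequality.{u, v, w} 𝕜 X p A β' := by
  intro Ω m μ hμ ℱ d hd N ε hε
  refine (h Ω m μ hμ ℱ d hd N ε hε).trans ?_
  gcongr

section Difference

variable {Ω : Type w} {m : MeasurableSpace Ω} {μ : Measure Ω}
  {ℱ : Filtration ℕ m} {d : ℕ → Ω → X}

theorem IsLpMartingaleDifference.memLp_sum (hd : IsLpMartingaleDifference p d ℱ μ) (N : ℕ)
    (ε : ℕ → 𝕜) :
    MemLp (fun ω => ∑ n ∈ Finset.range N, ε n • d n ω) (ENNReal.ofReal p) μ :=
  memLp_finsetSum _ fun n _ => (hd.memLp n).const_smul (ε n)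

theorem IsLpMartingaleDifference.memLp_partialSum (hd : IsLpMartingaleDifference p d ℱ μ)
    (N : ℕ) : MemLp (fun ω => ∑ n ∈ Finset.range N, d n ω) (ENNReal.ofReal p) μ :=
  memLp_finsetSum _ fun n _ => hd.memLp n

theorem IsLpMartingaleDifference.martingale_transform [IsProbabilityMeasure μ] (hp : 1 ≤ p)
    (hd : IsLpMartingaleDifference p d ℱ μ) (ε : ℕ → 𝕜) :
    Martingale (fun n ω => ∑ k ∈ Finset.range (n + 1), ε k • d k ω) ℱ μ := by
  have hint : ∀ n, Integrable (d n) μ := fun n => (hd.memLp n).integrable (by simpa using hp)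
  have h0 : StronglyMeasurable[ℱ 0] (d 0) := by simpa using hd.martingale.1 0
  have hsucc : ∀ n, StronglyMeasurable[ℱ (n + 1)] (d (n + 1)) := fun n => by
    have h1 := (hd.martingale.1 (n + 1)).sub ((hd.martingale.1 n).mono (ℱ.mono (Nat.le_succ n)))
    convert h1 using 1
    ext ω
    simp [Finset.sum_range_succ _ (n + 1)]
  have hzero : ∀ n s, MeasurableSet[ℱ n] s → ∫ ω in s, d (n + 1) ω ∂μ = 0 := by
    intro n s hs
    have h1 := hd.martingale.setIntegral_eq (Nat.le_succ n) hs
    have e : ∀ ω, ∑ k ∈ Finset.range (n.succ + 1), d k ω =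
        ∑ k ∈ Finset.range (n + 1), d k ω + d (n + 1) ω := fun ω => Finset.sum_range_succ _ _
    simp_rw [e] at h1
    rw [integral_add (hd.martingale.integrable n).integrableOn (hint _).integrableOn] at h1
    exact left_eq_add.1 h1
  refine martingale_of_setIntegral_eq_succ ?_ ?_ ?_
  · intro n
    induction n with
    | zero =>
      simp only [zero_add, Finset.sum_range_one]
      exact h0.const_smul (ε 0)
    | succ n ih =>
      simp_rw [Finset.sum_range_succ _ (n + 1)]
      exact (ih.mono (ℱ.mono (Nat.le_succ n))).add ((hsucc n).const_smul (ε (n + 1)))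
  · exact fun n => integrable_finsetSum _ fun k _ => (hint k).smul (ε k)
  · intro n s hs
    simp_rw [Finset.sum_range_succ _ (n + 1)]
    have hi : ∀ k, Integrable (fun ω => ε k • d k ω) μ := fun k => (hint k).smul (ε k)
    rw [integral_add (integrable_finsetSum _ fun k _ => hi k).integrableOn
      (hi _).integrableOn, integral_smul, hzero n s hs, smul_zero, add_zero]

end Difference

theorem SubordinationInequality.umdInequality (hp : 1 ≤ p) (hA : A.Nonempty) {β : ℝ≥0∞}
    (h : SubordinationInequality.{u, v, w} 𝕜 X p A β) : UMDInequality.{u, v, w} 𝕜 X p A β := by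
  classical
  intro Ω m μ hμ ℱ d hd N ε hε
  obtain ⟨α, hα⟩ := hA
  rcases N with _ | N
  · simp
  -- Subordination is required at all times, so the coefficients are continued by a point of `A`.
  -- The sum of `N + 1` terms is the process at time `N`.
  set e : ℕ → 𝕜 := fun n => if n < N + 1 then ε n else α with he
  have heA : ∀ n, e n ∈ A := fun n => by
    simp only [he]
    split_ifs with hn
    · exact hε n hn
    · exact hα
  have hq : ∀ n (φ : StrongDual 𝕜 X) (x : X), QuotientMem A (φ (e n • x)) (φ x) := by
    intro n φ x
    rw [map_smul, smul_eq_mul]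
    exact ⟨fun h0 => by rw [h0, mul_zero], fun h0 => by rw [mul_div_cancel_right₀ _ h0]; exact heA n⟩
  have key := h Ω m μ hμ ℱ (fun n ω => ∑ k ∈ Finset.range (n + 1), d k ω)
    (fun n ω => ∑ k ∈ Finset.range (n + 1), e k • d k ω)
    ⟨hd.martingale.1, Locally.of_prop hd.martingale⟩
    ⟨(hd.martingale_transform hp e).1, Locally.of_prop (hd.martingale_transform hp e)⟩
    ⟨fun φ => ae_of_all _ fun ω => by simpa using hq 0 φ (d 0 ω),
      fun φ n => ae_of_all _ fun ω => by
        rw [Finset.sum_range_succ _ (n + 1), Finset.sum_range_succ _ (n + 1), add_sub_cancel_left,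
          add_sub_cancel_left]
        exact hq _ φ _⟩ N
  rw [eLpNorm_le_mul_iff_lintegral (by linarith)]
  have e1 : ∀ ω, ∑ n ∈ Finset.range (N + 1), ε n • d n ω =
      ∑ n ∈ Finset.range (N + 1), e n • d n ω := fun ω =>
    Finset.sum_congr rfl fun n hn => by rw [he]; simp only [if_pos (Finset.mem_range.1 hn)]
  simp_rw [e1]
  exact key

/-- The infimum is attained: for finite nonzero `L`, each instance says that a fixed quotient is at
most every admissible constant. The given `β` is needed when `L = 0`. -/
theorem umdInequality_umdConst {β : ℝ≥0∞} (h : UMDInequality.{u, v, w} 𝕜 X p A β) :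
    UMDInequality.{u, v, w} 𝕜 X p A (umdConst.{u, v, w} 𝕜 X p A) := by
  intro Ω m μ hμ ℱ d hd N ε hε
  set L := eLpNorm (fun ω => ∑ n ∈ Finset.range N, d n ω) (ENNReal.ofReal p) μ
  have hL : L ≠ ∞ := (hd.memLp_partialSum N).2.ne
  rcases eq_or_ne L 0 with h0 | h0
  · have := h Ω m μ hμ ℱ d hd N ε hε
    change _ ≤ β * L at this
    rw [h0, mul_zero] at this
    exact this.trans zero_le
  · rw [← ENNReal.div_le_iff h0 hL]
    refine le_sInf fun β' hβ' => ?_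
    rw [ENNReal.div_le_iff h0 hL]
    exact hβ' Ω m μ hμ ℱ d hd N ε hε

theorem UMDInequality.exists_sphere (hp : 1 ≤ p) (hA : IsScalarBody A) {β : ℝ≥0}
    (h : UMDInequality.{u, v, w} 𝕜 X p A β) :
    ∃ β' : ℝ≥0, 0 < β' ∧ UMDInequality.{u, v, w} 𝕜 X p {ε : 𝕜 | ‖ε‖ = 1} β' := by
  obtain ⟨α, hα, γ, hγ, hne⟩ := hA.nontrivial
  have hne' : γ - α ≠ 0 := sub_ne_zero.2 hne.symm
  -- The affine map with `α ↦ -1` and `γ ↦ 1` carries the segment between them, which lies in `A`,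
  -- onto `[-1, 1]`; `K` bounds the transforms with coefficients in `[-1, 1]`. Real and imaginary
  -- parts give `2 * K`, and the summand `1` ensures positivity.
  set K : ℝ≥0 := ‖2 / (γ - α)‖₊ * β + ‖(α + γ) / (γ - α)‖₊
  refine ⟨2 * K + 1, by positivity, ?_⟩
  intro Ω m μ hμ ℱ d hd N ε hε
  set L := eLpNorm (fun ω => ∑ n ∈ Finset.range N, d n ω) (ENNReal.ofReal p) μ
  have hp' : (1 : ℝ≥0∞) ≤ ENNReal.ofReal p := by simpa using hp
  have real : ∀ s : ℕ → ℝ, (∀ n < N, |s n| ≤ 1) →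
      eLpNorm (fun ω => ∑ n ∈ Finset.range N, (s n : 𝕜) • d n ω) (ENNReal.ofReal p) μ ≤
        K * L := by
    intro s hs
    set a : ℕ → 𝕜 := fun n => ((1 + s n) / 2) • γ + ((1 - s n) / 2) • α
    have haA : ∀ n < N, a n ∈ A := fun n hn => by
      have := abs_le.1 (hs n hn)
      exact hA.convex hγ hα (by linarith) (by linarith) (by ring)
    have hsa : ∀ n, (s n : 𝕜) = 2 / (γ - α) * a n - (α + γ) / (γ - α) := by
      intro n
      simp only [a, RCLike.real_smul_eq_coe_mul]
      push_cast
      field_simp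
      ring
    have e : (fun ω => ∑ n ∈ Finset.range N, (s n : 𝕜) • d n ω) =
        (2 / (γ - α)) • (fun ω => ∑ n ∈ Finset.range N, a n • d n ω) -
        ((α + γ) / (γ - α)) • fun ω => ∑ n ∈ Finset.range N, d n ω := by
      ext ω
      simp only [hsa, Pi.sub_apply, Pi.smul_apply, Finset.smul_sum, sub_smul,
        Finset.sum_sub_distrib, smul_smul]
    rw [e]
    refine (eLpNorm_sub_le ((hd.memLp_sum N a).1.const_smul _)
      ((hd.memLp_partialSum N).1.const_smul _) hp').trans ?_
    rw [eLpNorm_const_smul, eLpNorm_const_smul]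
    have h1 := h Ω m μ hμ ℱ d hd N a haA
    simp only [K, ENNReal.coe_add, ENNReal.coe_mul, add_mul, mul_assoc]
    exact add_le_add (mul_le_mul_right h1 _) le_rfl
  have e : (fun ω => ∑ n ∈ Finset.range N, ε n • d n ω) =
      (fun ω => ∑ n ∈ Finset.range N, ((RCLike.re (ε n) : ℝ) : 𝕜) • d n ω) +
      (RCLike.I : 𝕜) • fun ω => ∑ n ∈ Finset.range N, ((RCLike.im (ε n) : ℝ) : 𝕜) • d n ω := by
    ext ω
    simp only [Pi.add_apply, Pi.smul_apply, Finset.smul_sum, smul_smul, ← Finset.sum_add_distrib,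
      ← add_smul]
    refine Finset.sum_congr rfl fun n _ => ?_
    rw [mul_comm, RCLike.re_add_im]
  rw [e]
  refine (eLpNorm_add_le (hd.memLp_sum N _).1 ((hd.memLp_sum N _).1.const_smul _) hp').trans ?_
  rw [eLpNorm_const_smul]
  have hI : ‖(RCLike.I : 𝕜)‖ₑ ≤ 1 := by
    rw [← ofReal_norm, ← ENNReal.ofReal_one]
    refine ENNReal.ofReal_le_ofReal ?_
    rcases RCLike.I_mul_I_ax (K := 𝕜) with h0 | h0
    · rw [h0, norm_zero]; exact zero_le_one
    · have h1 := congrArg norm h0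
      rw [norm_mul, norm_neg, norm_one] at h1
      nlinarith [norm_nonneg (RCLike.I : 𝕜)]
  have h1 := real (fun n => RCLike.re (ε n)) fun n hn =>
    (RCLike.abs_re_le_norm (ε n)).trans (hε n hn).le
  have h2 := real (fun n => RCLike.im (ε n)) fun n hn =>
    (RCLike.abs_im_le_norm (ε n)).trans (hε n hn).le
  calc _ ≤ K * L + 1 * (K * L) := by gcongr
    _ = (2 * K) * L := by ring
    _ ≤ _ := by
      push_cast
      gcongr
      exact le_self_add

variable [IsScalarTower ℝ 𝕜 X]

/-- The `L^p` norm of the transform is convex in the coefficient vector, so the bound passes from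
products of unit spheres to their convex hull, the product of unit balls. Scaling by `M` reaches
`A`. -/
theorem UMDInequality.of_sphere (hp : 1 ≤ p) {C : ℝ≥0∞}
    (h : UMDInequality.{u, v, w} 𝕜 X p {ε : 𝕜 | ‖ε‖ = 1} C) {M : ℝ≥0} (hM0 : M ≠ 0)
    (hM : ∀ ε ∈ A, ‖ε‖ ≤ M) : UMDInequality.{u, v, w} 𝕜 X p A (M * C) := by
  intro Ω m μ hμ ℱ d hd N ε hε
  set L := eLpNorm (fun ω => ∑ n ∈ Finset.range N, d n ω) (ENNReal.ofReal p) μ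
  have hp' : (1 : ℝ≥0∞) ≤ ENNReal.ofReal p := by simpa using hp
  set T : (Fin N → 𝕜) → Ω → X := fun η ω => ∑ n : Fin N, η n • d n ω
  have hT : ∀ η, MemLp (T η) (ENNReal.ofReal p) μ := fun η =>
    memLp_finsetSum _ fun n _ => (hd.memLp n).const_smul (η n)
  set 𝒞 : Set (Fin N → 𝕜) := {η | eLpNorm (T η) (ENNReal.ofReal p) μ ≤ C * L}
  have hconv : Convex ℝ 𝒞 := by
    intro η hη η' hη' a b ha hb hab
    have e : T (a • η + b • η') = a • T η + b • T η' := by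
      ext ω
      simp only [T, Pi.add_apply, Pi.smul_apply, add_smul, Finset.sum_add_distrib,
        Finset.smul_sum, smul_assoc]
    change eLpNorm (T (a • η + b • η')) _ _ ≤ _
    rw [e]
    refine (eLpNorm_add_le ((hT η).1.const_smul a) ((hT η').1.const_smul b) hp').trans ?_
    rw [eLpNorm_const_smul, eLpNorm_const_smul]
    calc ‖a‖ₑ * eLpNorm (T η) (ENNReal.ofReal p) μ + ‖b‖ₑ * eLpNorm (T η') (ENNReal.ofReal p) μ
        ≤ ‖a‖ₑ * (C * L) + ‖b‖ₑ * (C * L) := by gcongr <;> assumption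
      _ = C * L := by
        rw [← add_mul, Real.enorm_of_nonneg ha, Real.enorm_of_nonneg hb,
          ← ENNReal.ofReal_add ha hb, hab, ENNReal.ofReal_one, one_mul]
  have hsub : (Set.univ : Set (Fin N)).pi (fun _ => Metric.sphere (0 : 𝕜) 1) ⊆ 𝒞 := by
    intro η hη
    have := h Ω m μ hμ ℱ d hd N (fun n => if hn : n < N then η ⟨n, hn⟩ else 0) (fun n hn => by
      simpa [hn] using hη ⟨n, hn⟩ trivial)
    simp_rw [Finset.sum_range (n := N) (f := fun n => (if hn : n < N then η ⟨n, hn⟩ else 0) • _)]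
      at this
    simpa [𝒞, T, L] using this
  have hball : ∀ η : Fin N → 𝕜, (∀ n, ‖η n‖ ≤ 1) → η ∈ 𝒞 := by
    intro η hη
    refine convexHull_min hsub hconv ?_
    rw [convexHull_pi]
    intro n _
    rw [convexHull_sphere_eq_closedBall _ zero_le_one]
    simpa using hη n
  have hMpos : (0 : ℝ) < M := by positivity
  have hη := hball (fun n => (M : ℝ)⁻¹ • ε n) (fun n => by
    rw [norm_smul, norm_inv, Real.norm_of_nonneg hMpos.le, inv_mul_le_iff₀ hMpos, mul_one]
    exact hM _ (hε n n.2))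
  have e1 : (fun ω => ∑ n ∈ Finset.range N, ε n • d n ω) =
      (M : ℝ) • T fun n => (M : ℝ)⁻¹ • ε n := by
    ext ω
    simp only [T, Pi.smul_apply, Finset.smul_sum, ← smul_assoc]
    rw [Finset.sum_range]
    refine Finset.sum_congr rfl fun n _ => ?_
    rw [smul_eq_mul, mul_inv_cancel₀ hMpos.ne', one_smul]
  rw [e1, eLpNorm_const_smul, mul_assoc]
  have e2 : ‖(M : ℝ)‖ₑ = M := by simp
  rw [e2]
  gcongr
  exact hη

theorem nontrivial_sphere_one : ({ε : 𝕜 | ‖ε‖ = 1} : Set 𝕜).Nontrivial := by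
  refine ⟨1, by simp, -1, by simp, fun h => ?_⟩
  have : (2 : 𝕜) = 0 := by linear_combination h
  norm_num at this

theorem WalshUMD.umdInequality (hp : 1 ≤ p) {B : ℝ} (hB : 0 ≤ B) (hAb : Bornology.IsBounded A)
    (hA : A.Nontrivial) (h : WalshUMD 𝕜 X p A B) :
    ∃ β : ℝ≥0, UMDInequality.{u, v, w} 𝕜 X p A β := by
  classical
  have hp0 : 0 < p := by linarith
  refine ⟨(B ^ p⁻¹).toNNReal, ?_⟩
  intro Ω m μ hμ ℱ d hd N ε hε
  obtain ⟨α, hα⟩ := hA.nonempty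
  rcases N with _ | N
  · simp
  set e : ℕ → 𝕜 := fun n => if n < N + 1 then ε n else α with he
  have heA : ∀ n, e n ∈ A := fun n => by
    simp only [he]
    split_ifs with hn
    · exact hε n hn
    · exact hα
  have hG := hd.martingale_transform hp e
  have hzero : ∀ {Y : ℕ → Ω → X}, Martingale Y ℱ μ → ∀ n, ∀ s, MeasurableSet[ℱ n] s →
      ∫ ω in s, (Y (n + 1) ω - Y n ω) ∂μ = 0 := by
    intro Y hY n s hs
    rw [integral_sub (hY.integrable _).integrableOn (hY.integrable _).integrableOn,
      hY.setIntegral_eq (Nat.le_succ n) hs, sub_self]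
  have key := h.lintegral_le (μ := μ) hp hB hA hAb ℱ
    (f := fun n ω => ∑ k ∈ Finset.range (n + 1), d k ω)
    (g := fun n ω => ∑ k ∈ Finset.range (n + 1), e k • d k ω) (a := fun n _ => e n) (N := N)
    (fun n _ => hd.martingale.1 n) (fun n _ => hG.1 n) (fun n _ => hd.memLp_partialSum _)
    (fun n _ => hd.memLp_sum _ e) (fun n _ => hzero hd.martingale n) (fun n _ => hzero hG n)
    (fun n => measurable_const) (fun n _ => heA n) (ae_of_all _ fun ω => by simp)
    (fun n _ => ae_of_all _ fun ω => by
      rw [Finset.sum_range_succ _ (n + 1), Finset.sum_range_succ _ (n + 1), add_sub_cancel_left,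
        add_sub_cancel_left])
  rw [eLpNorm_le_mul_iff_lintegral hp0]
  have e1 : ∀ ω, ∑ n ∈ Finset.range (N + 1), ε n • d n ω =
      ∑ n ∈ Finset.range (N + 1), e n • d n ω := fun ω =>
    Finset.sum_congr rfl fun n hn => by rw [he]; simp only [if_pos (Finset.mem_range.1 hn)]
  simp_rw [e1]
  have e2 : ((B ^ p⁻¹).toNNReal : ℝ≥0∞) ^ p = ENNReal.ofReal B := by
    change ENNReal.ofReal (B ^ p⁻¹) ^ p = _
    rw [ENNReal.ofReal_rpow_of_nonneg (by positivity) hp0.le, Real.rpow_inv_rpow hB hp0.ne']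
  rw [e2]
  exact key

/-- The UMD property implies the UMD inequality for all exponents and all scalar bodies. -/
theorem IsUMD.exists_umdInequality (h : IsUMD.{u, v, w} 𝕜 X) (hp : 1 < p)
    (hA : Bornology.IsBounded A) : ∃ β : ℝ≥0, UMDInequality.{u, v, w} 𝕜 X p A β := by
  obtain ⟨q, hq, β, -, hβ⟩ := h
  have hq0 : 0 < q := by linarith
  -- The exponent is changed on the unit sphere, where coefficients have modulus one; only
  -- afterwards does one pass to `A`.
  obtain ⟨C, hC, hW⟩ := (hβ.walshUMD hq0).extrapolate hq0 (by positivity) nontrivial_sphere_one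
    (fun ε hε => le_of_eq hε) hp
  have hb : Bornology.IsBounded ({ε : 𝕜 | ‖ε‖ = 1} : Set 𝕜) :=
    isBounded_iff_forall_norm_le.2 ⟨1, fun ε hε => le_of_eq hε⟩
  obtain ⟨β', hβ'⟩ := WalshUMD.umdInequality.{u, v, w} hp.le hC hb nontrivial_sphere_one hW
  obtain ⟨M, hM⟩ := hA.exists_norm_le
  refine ⟨(M.toNNReal + 1) * β', ?_⟩
  rw [ENNReal.coe_mul]
  refine hβ'.of_sphere hp.le (by positivity) fun ε hε => (hM ε hε).trans ?_
  push_cast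
  linarith [Real.le_coe_toNNReal M]

theorem UMDInequality.subordinationInequality (hp : 1 < p) (hA : IsScalarBody A) {β : ℝ≥0}
    (h : UMDInequality.{u, v, w} 𝕜 X p A β) : SubordinationInequality.{u, v, w} 𝕜 X p A β := by
  have hp0 : 0 < p := by linarith
  have hW := h.walshUMD hp0
  intro Ω m μ hμ ℱ f g hf hg hsub n
  have hp' : (1 : ℝ≥0∞) ≤ ENNReal.ofReal p := by simpa using hp.le
  rcases eq_or_ne (∫⁻ ω, ‖f n ω‖ₑ ^ p ∂μ) ∞ with htop | htop
  -- The right-hand side is infinite unless `β = 0`, where `0 * ∞ = 0`. In that case a one-leaf tree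
  -- with a nonzero coefficient from `A` forces `X` to be trivial.
  · rcases eq_or_ne β 0 with rfl | hβ
    · obtain ⟨ε, hε, hε0⟩ := hA.nontrivial.exists_ne 0
      have hX : ∀ x : X, x = 0 := by
        intro x
        have := hW .leaf trivial x ε hε
        simp only [WalshTree.mean, WalshTree.run, powGain, NNReal.coe_zero,
          Real.zero_rpow hp0.ne', zero_mul, sub_zero] at this
        have h0 : ‖ε • x‖ ^ p = 0 := le_antisymm this (by positivity)
        rw [Real.rpow_eq_zero (norm_nonneg _) hp0.ne', norm_eq_zero] at h0
        exact (smul_eq_zero.1 h0).resolve_left hε0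
      have : ∀ ω, g n ω = 0 := fun ω => hX _
      simp [this, ENNReal.zero_rpow_of_pos hp0]
    · rw [htop, ENNReal.mul_top]
      · exact le_top
      · simp [hβ]
  have hfm : ∀ k, StronglyMeasurable (f k) := fun k => (hf.1 k).mono (ℱ.le k)
  have hgm : ∀ k, StronglyMeasurable (g k) := fun k => (hg.1 k).mono (ℱ.le k)
  have hfn : MemLp (f n) (ENNReal.ofReal p) μ := by
    refine ⟨(hfm n).aestronglyMeasurable, ?_⟩
    rw [eLpNorm_eq_lintegral_rpow_enorm_toReal (by simpa using hp0) ENNReal.ofReal_ne_top,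
      ENNReal.toReal_ofReal hp0.le]
    exact ENNReal.rpow_lt_top_of_nonneg (by positivity) htop
  have hfL : ∀ k ≤ n, MemLp (f k) (ENNReal.ofReal p) μ := fun k hk => hf.memLp_of_le hp' hfn hk
  obtain ⟨a₀, ham₀, ha₀, hae₀⟩ := exists_measurable_coeff hA.bounded hA.closed
    hA.nontrivial.nonempty (hfm 0) (hgm 0) hsub.zero
  choose a ham ha hae using fun k => exists_measurable_coeff hA.bounded hA.closed
    hA.nontrivial.nonempty ((hfm (k + 1)).sub (hfm k)) ((hgm (k + 1)).sub (hgm k))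
    (fun φ => hsub.succ φ k)
  obtain ⟨M, hM⟩ := hA.bounded.exists_norm_le
  have hmul : ∀ {b : Ω → 𝕜} {F G : Ω → X}, (∀ ω, b ω ∈ A) → StronglyMeasurable G →
      MemLp F (ENNReal.ofReal p) μ → (∀ᵐ ω ∂μ, G ω = b ω • F ω) →
      MemLp G (ENNReal.ofReal p) μ := by
    intro b F G hb hG hF hbG
    refine hF.of_le_mul (c := M) hG.aestronglyMeasurable ?_
    filter_upwards [hbG] with ω hω
    rw [hω, norm_smul]
    exact mul_le_mul_of_nonneg_right (hM _ (hb ω)) (norm_nonneg _)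
  have hgL : ∀ k ≤ n, MemLp (g k) (ENNReal.ofReal p) μ := by
    intro k
    induction k with
    | zero => exact fun hk => hmul ha₀ (hgm 0) (hfL 0 hk) hae₀
    | succ k ih =>
      intro hk
      have := (hmul (ha k) ((hgm (k + 1)).sub (hgm k))
        ((hfL (k + 1) hk).sub (hfL k (by omega))) (hae k)).add (ih (by omega))
      simpa using this
  have int : ∀ {F : Ω → X}, MemLp F (ENNReal.ofReal p) μ → Integrable F μ := fun hF =>
    hF.integrable hp'
  have key := hW.lintegral_le (μ := μ) hp.le (by positivity) hA.nontrivial hA.bounded ℱ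
    (f := f) (g := g) (N := n) (a := fun k => k.casesOn a₀ a) (fun k _ => hf.1 k)
    (fun k _ => hg.1 k) hfL hgL
    (fun k hk s hs => hf.setIntegral_sub_eq_zero (int (hfL k hk.le)) (int (hfL (k + 1) hk)) hs)
    (fun k hk s hs => hg.setIntegral_sub_eq_zero (int (hgL k hk.le)) (int (hgL (k + 1) hk)) hs)
    (by rintro (_ | k)
        · exact ham₀
        · exact ham k)
    (by rintro (_ | k)
        · exact ha₀
        · exact ha k) hae₀ (fun k _ => hae k)
  rwa [← ENNReal.ofReal_rpow_of_nonneg β.coe_nonneg hp0.le, ENNReal.ofReal_coe_nnreal] at key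

end Transfer

/-! ### The equivalences and the sharp constant -/

theorem theorem3p7 {𝕜 : Type u} [RCLike 𝕜] {X : Type v} [NormedAddCommGroup X] [NormedSpace 𝕜 X]
    [NormedSpace ℝ X] [IsScalarTower ℝ 𝕜 X] [CompleteSpace X] :
    (IsUMD.{u, v, w} 𝕜 X ↔
      ∃ (p : ℝ) (A : Set 𝕜), 1 < p ∧ IsScalarBody A ∧
        ∃ β : ℝ≥0, 0 < β ∧ SubordinationInequality.{u, v, w} 𝕜 X p A β) ∧
    (IsUMD.{u, v, w} 𝕜 X ↔
      ∀ (p : ℝ) (A : Set 𝕜), 1 < p → IsScalarBody A →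
        ∃ β : ℝ≥0, 0 < β ∧ SubordinationInequality.{u, v, w} 𝕜 X p A β) ∧
    (IsUMD.{u, v, w} 𝕜 X →
      ∀ (p : ℝ) (A : Set 𝕜), 1 < p → IsScalarBody A →
        umdConst.{u, v, w} 𝕜 X p A < ∞ ∧
        IsLeast {β : ℝ≥0∞ | SubordinationInequality.{u, v, w} 𝕜 X p A β}
          (umdConst.{u, v, w} 𝕜 X p A))
    := by
  -- The unit sphere is not convex; the closed ball serves as a concrete scalar body when one has to
  -- be exhibited.
  have hball : IsScalarBody (Metric.closedBall (0 : 𝕜) 1) :=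
    ⟨convex_closedBall 0 1, Metric.isBounded_closedBall, Metric.isClosed_closedBall,
      nontrivial_sphere_one.mono fun ε hε => by simpa using le_of_eq hε⟩
  have hall : IsUMD.{u, v, w} 𝕜 X → ∀ (p : ℝ) (A : Set 𝕜), 1 < p → IsScalarBody A →
      ∃ β : ℝ≥0, 0 < β ∧ SubordinationInequality.{u, v, w} 𝕜 X p A β := by
    intro h p A hp hA
    obtain ⟨β, hβ⟩ := h.exists_umdInequality hp hA.bounded
    exact ⟨β + 1, by positivity,
      (hβ.mono (by push_cast; exact le_self_add)).subordinationInequality hp hA⟩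
  have hex : (∃ (p : ℝ) (A : Set 𝕜), 1 < p ∧ IsScalarBody A ∧
      ∃ β : ℝ≥0, 0 < β ∧ SubordinationInequality.{u, v, w} 𝕜 X p A β) → IsUMD.{u, v, w} 𝕜 X := by
    rintro ⟨p, A, hp, hA, β, -, hβ⟩
    exact ⟨p, hp, (hβ.umdInequality hp.le hA.nontrivial.nonempty).exists_sphere hp.le hA⟩
  refine ⟨⟨fun h => ⟨2, _, one_lt_two, hball, hall h 2 _ one_lt_two hball⟩, hex⟩,
    ⟨hall, fun h => hex ⟨2, _, one_lt_two, hball, h 2 _ one_lt_two hball⟩⟩,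
    fun h p A hp hA => ?_⟩
  obtain ⟨β, hβ⟩ := h.exists_umdInequality hp hA.bounded
  have hlt : umdConst.{u, v, w} 𝕜 X p A < ∞ := (sInf_le hβ).trans_lt ENNReal.coe_lt_top
  refine ⟨hlt, ?_, fun β' hβ' => sInf_le (SubordinationInequality.umdInequality hp.le
    hA.nontrivial.nonempty hβ')⟩
  have h1 := umdInequality_umdConst hβ
  rw [← ENNReal.coe_toNNReal hlt.ne] at h1
  have h2 := h1.subordinationInequality hp hA
  rwa [ENNReal.coe_toNNReal hlt.ne] at h2
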